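/- Let $d\ge 1$ and $n\ge 3$ be integers and let $u\in\mathbb{C}$, $u\neq 0$. For $m\ge 0$ let ${\rm Y}_{d,m}(u)$ be the Yokonuma--Hecke algebra: the unital associative $\mathbb{C}$-algebra generated by $g_1,\dots,g_{m-1},t_1,\dots,t_m$ with relations $g_ig_j=g_jg_i$ for $|i-j|>1$, $g_{i+1}g_ig_{i+1}=g_ig_{i+1}g_i$, $t_it_j=t_jt_i$, $t_i^d=1$, $g_it_i=t_{i+1}g_i$, $g_it_{i+1}=t_ig_i$, $g_it_j=t_jg_i$ for $j\ne i,i+1$, and $g_i^2=1+(u-1)e_i+(u-1)e_ig_i$, where $e_i=e_i^{(0)}$ and $$e_i^{(k)}=\frac1d\sum_{s=0}^{d-1}t_i^{k+s}t_{i+1}^{d-s}\qquad(0\le k\le d-1).$$ For $1\le i\le n-2$ put $$c_{i,i+1}=\sum_{p,q,r=0}^{d-1}t_i^pt_{i+1}^qt_{i+2}^r\,\bigl(1+g_i+g_{i+1}+g_ig_{i+1}+g_{i+1}g_i+g_ig_{i+1}g_i\bigr)\in{\rm Y}_{d,n}(u),$$ and let ${\rm CTL}_{d,n}(u)$, the Complex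 Reflection Temperley--Lieb algebra, be the quotient of ${\rm Y}_{d,n}(u)$ by the two-sided ideal generated by $c_{1,2},\dots,c_{n-2,n-1}$. Let $z\in\mathbb{C}$ and let $x:\mathbb{Z}/d\mathbb{Z}\to\mathbb{C}$, $k\mapsto x_k$, satisfy $x_0=1$. A Markov trace with parameters $z,x_1,\dots,x_{d-1}$ is a family of linear maps ${\rm tr}:{\rm Y}_{d,m}(u)\to\mathbb{C}$ $(m\ge0)$, compatible with the natural maps ${\rm Y}_{d,m}(u)\to{\rm Y}_{d,m+1}(u)$, such that ${\rm tr}(1)=1$, ${\rm tr}(ab)={\rm tr}(ba)$, ${\rm tr}(ag_m)=z\,{\rm tr}(a)$ for $a\in{\rm Y}_{d,m}(u)$, $m\ge1$, and ${\rm tr}(at_{m+1}^s)=x_s\,{\rm tr}(a)$ for $a\in{\rm Y}_{d,m}(u)$, $m\ge 0$, $1\le s\le d-1$. Put $E^{(k)}=\frac1d\sum_{s\in\mathbb{Z}/d\mathbb{Z}}x_{k+s}x_{-s}$. The $x_k$ satisfy the E-condition if $E^{(k)}=x_kE^{(0)}$ for $1\le k\le d-1$. Then: (1) For all such $z$ and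 $x$ there is exactly one Markov trace ${\rm tr}$ with parameters $z,x_1,\dots,x_{d-1}$, and its restriction to ${\rm Y}_{d,n}(u)$ passes to (that is, factors through) the quotient ${\rm CTL}_{d,n}(u)$ if and only if $$(u+1)z^2\sum_{k\in\mathbb{Z}/d\mathbb{Z}}x_k+(u+2)z\sum_{k\in\mathbb{Z}/d\mathbb{Z}}E^{(k)}+\sum_{k\in\mathbb{Z}/d\mathbb{Z}}{\rm tr}\bigl(e_1^{(k)}e_2\bigr)=0 .$$ (2) Passing to ${\rm CTL}_{d,n}(u)$ does not force the E-condition: if $d\ge2$, there are parameters $z,x_1,\dots,x_{d-1}$ for which ${\rm tr}$ passes to ${\rm CTL}_{d,n}(u)$ although the $x_k$ do not satisfy the E-condition. -/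

import Mathlib

noncomputable section

namespace YokonumaHecke

/-- Generators of the Yokonuma-Hecke algebra on `n` strands. Strands are numbered `0, …, n - 1`:
`g i` is the braiding generator of the strands `i, i + 1`, and `t j` is the framing generator
of the strand `j`. -/
inductive Gen (n : ℕ) : Type
  | g (i : ℕ) (hi : i + 1 < n) : Gen n
  | t (j : ℕ) (hj : j < n) : Gen n

/-- `(1/d) ∑_{s=0}^{d-1} a^{m+s} b^{d-s}`. For `a = t_i`, `b = t_{i+1}` this is `e_i^{(m)}`. -/
def framingAverage (d : ℕ) {A : Type*} [Ring A] [Algebra ℂ A] (m : ℕ) (a b : A) : A :=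
  ((1 : ℂ) / (d : ℂ)) • ∑ s ∈ Finset.range d, a ^ (m + s) * b ^ (d - s)

/-- The generator `g_i` in the free algebra. -/
def freeG {n : ℕ} (i : ℕ) (hi : i + 1 < n) : FreeAlgebra ℂ (Gen n) :=
  FreeAlgebra.ι ℂ (Gen.g i hi)

/-- The generator `t_j` in the free algebra. -/
def freeT {n : ℕ} (j : ℕ) (hj : j < n) : FreeAlgebra ℂ (Gen n) :=
  FreeAlgebra.ι ℂ (Gen.t j hj)

/-- The defining relations of the Yokonuma-Hecke algebra. -/
inductive Rel (d n : ℕ) (u : ℂ) : FreeAlgebra ℂ (Gen n) → FreeAlgebra ℂ (Gen n) → Prop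
  | g_comm (i j : ℕ) (hi : i + 1 < n) (hj : j + 1 < n) (hij : i + 1 < j ∨ j + 1 < i) :
      Rel d n u (freeG i hi * freeG j hj) (freeG j hj * freeG i hi)
  | braid (i : ℕ) (hi : i + 1 < n) (hi' : i + 1 + 1 < n) :
      Rel d n u (freeG (i + 1) hi' * freeG i hi * freeG (i + 1) hi')
        (freeG i hi * freeG (i + 1) hi' * freeG i hi)
  | t_comm (i j : ℕ) (hi : i < n) (hj : j < n) :
      Rel d n u (freeT i hi * freeT j hj) (freeT j hj * freeT i hi)
  | t_pow (i : ℕ) (hi : i < n) : Rel d n u (freeT i hi ^ d) 1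
  | g_t_left (i : ℕ) (hi : i + 1 < n) (hi' : i < n) :
      Rel d n u (freeG i hi * freeT i hi') (freeT (i + 1) hi * freeG i hi)
  | g_t_right (i : ℕ) (hi : i + 1 < n) (hi' : i < n) :
      Rel d n u (freeG i hi * freeT (i + 1) hi) (freeT i hi' * freeG i hi)
  | g_t_comm (i j : ℕ) (hi : i + 1 < n) (hj : j < n) (h1 : j ≠ i) (h2 : j ≠ i + 1) :
      Rel d n u (freeG i hi * freeT j hj) (freeT j hj * freeG i hi)
  | quadratic (i : ℕ) (hi : i + 1 < n) (hi' : i < n) :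
      Rel d n u (freeG i hi ^ 2)
        (1 + (u - 1) • framingAverage d 0 (freeT i hi') (freeT (i + 1) hi)
          + (u - 1) • (framingAverage d 0 (freeT i hi') (freeT (i + 1) hi) * freeG i hi))

/-- The Yokonuma-Hecke algebra `Y_{d,n}(u)`, presented by generators and relations. -/
abbrev Y (d n : ℕ) (u : ℂ) : Type := RingQuot (Rel d n u)

section Elements

variable {d n : ℕ} {u : ℂ}

/-- The generator `g_i` of `Y_{d,n}(u)`. -/
def g (i : ℕ) (hi : i + 1 < n) : Y d n u := RingQuot.mkAlgHom ℂ (Rel d n u) (freeG i hi)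

/-- The generator `t_j` of `Y_{d,n}(u)`. -/
def t (j : ℕ) (hj : j < n) : Y d n u := RingQuot.mkAlgHom ℂ (Rel d n u) (freeT j hj)

/-- The element `e_i^{(m)}` of `Y_{d,n}(u)`, the shift of `e_i` by `m`. -/
def e (m i : ℕ) (hi : i + 1 < n) : Y d n u :=
  framingAverage d m (t i (Nat.lt_of_succ_lt hi)) (t (i + 1) hi)

/-- The sum of the `g_w` over the six elements `w` of `⟨s_i, s_{i+1}⟩`, written through their
reduced words `1, s_i, s_{i+1}, s_i s_{i+1}, s_{i+1} s_i, s_i s_{i+1} s_i`. -/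
def steinberg (i : ℕ) (hi : i + 2 < n) : Y d n u :=
  let a : Y d n u := g i (Nat.lt_of_succ_lt hi)
  let b : Y d n u := g (i + 1) hi
  1 + a + b + a * b + b * a + a * b * a

/-- The sum of the `g_c` over the subgroup
`⟨t_i, t_{i+1}, t_{i+2}⟩ ⋊ ⟨s_i, s_{i+1}⟩` of `C_d^n ⋊ S_n`, where
`g_c = t_i^p t_{i+1}^q t_{i+2}^r g_w` for `c = t_i^p t_{i+1}^q t_{i+2}^r w`. -/
def cElem (i : ℕ) (hi : i + 2 < n) : Y d n u :=
  ∑ p ∈ Finset.range d, ∑ q ∈ Finset.range d, ∑ r ∈ Finset.range d,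
    t i (Nat.lt_of_succ_lt (Nat.lt_of_succ_lt hi)) ^ p *
      t (i + 1) (Nat.lt_of_succ_lt hi) ^ q * t (i + 2) hi ^ r * steinberg i hi

end Elements

theorem map_framingAverage (d : ℕ) {A B : Type*} [Ring A] [Algebra ℂ A] [Ring B] [Algebra ℂ B]
    (f : A →ₐ[ℂ] B) (m : ℕ) (a b : A) :
    f (framingAverage d m a b) = framingAverage d m (f a) (f b) := by
  simp [framingAverage, map_sum]

/-- Images of the generators under the natural map `Y_{d,n}(u) → Y_{d,n+1}(u)`. -/
def inclGen (d n : ℕ) (u : ℂ) : Gen n → Y d (n + 1) u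
  | Gen.g i hi => g i (Nat.lt_succ_of_lt hi)
  | Gen.t j hj => t j (Nat.lt_succ_of_lt hj)

theorem inclGen_rel (d n : ℕ) (u : ℂ) ⦃a b : FreeAlgebra ℂ (Gen n)⦄ (h : Rel d n u a b) :
    FreeAlgebra.lift ℂ (inclGen d n u) a = FreeAlgebra.lift ℂ (inclGen d n u) b := by
  have hg : ∀ i (hi : i + 1 < n), FreeAlgebra.lift ℂ (inclGen d n u) (freeG i hi)
      = RingQuot.mkAlgHom ℂ (Rel d (n + 1) u) (freeG i (Nat.lt_succ_of_lt hi)) := by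
    intro i hi; simp [freeG, inclGen, g]
  have ht : ∀ i (hi : i < n), FreeAlgebra.lift ℂ (inclGen d n u) (freeT i hi)
      = RingQuot.mkAlgHom ℂ (Rel d (n + 1) u) (freeT i (Nat.lt_succ_of_lt hi)) := by
    intro i hi; simp [freeT, inclGen, t]
  induction h <;>
    simp only [map_mul, map_pow, map_add, map_one, map_smul, map_framingAverage, hg, ht] <;>
    simp only [← map_mul, ← map_pow, ← map_add, ← map_smul, ← map_framingAverage,
      ← map_one (RingQuot.mkAlgHom ℂ (Rel d (n + 1) u))] <;>
    apply RingQuot.mkAlgHom_rel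
  case g_comm hij => exact Rel.g_comm _ _ _ _ hij
  case braid => exact Rel.braid _ _ _
  case t_comm => exact Rel.t_comm _ _ _ _
  case t_pow => exact Rel.t_pow _ _
  case g_t_left => exact Rel.g_t_left _ _ _
  case g_t_right => exact Rel.g_t_right _ _ _
  case g_t_comm h1 h2 => exact Rel.g_t_comm _ _ _ _ h1 h2
  case quadratic => exact Rel.quadratic _ _ _

/-- The natural algebra map `Y_{d,n}(u) → Y_{d,n+1}(u)`, `g_i ↦ g_i`, `t_j ↦ t_j`. -/
def incl (d n : ℕ) (u : ℂ) : Y d n u →ₐ[ℂ] Y d (n + 1) u :=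
  RingQuot.liftAlgHom ℂ ⟨FreeAlgebra.lift ℂ (inclGen d n u), inclGen_rel d n u⟩

/-- `tr` is a Markov trace with parameters `z` and `x` on the tower of the algebras
`Y_{d,n}(u)`. A linear functional on the union of the tower is a family of functionals that is
compatible with the natural maps. In `tr_g` and `tr_t` the generator is the last one of the
larger algebra. (The functional on `Y_{d,0}(u) = ℂ`, and `tr_t` for `n = 0`, only add
`tr (t_0 ^ s) = x_s`, which for `u ≠ 0` also follows from the other rules.) -/
structure IsMarkovTrace (d : ℕ) (u z : ℂ) (x : ZMod d → ℂ)
    (tr : ∀ n : ℕ, Y d n u →ₗ[ℂ] ℂ) : Prop where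
  compat : ∀ (n : ℕ) (a : Y d n u), tr (n + 1) (incl d n u a) = tr n a
  mul_comm : ∀ (n : ℕ) (a b : Y d n u), tr n (a * b) = tr n (b * a)
  one : ∀ n : ℕ, tr n 1 = 1
  tr_g : ∀ (n : ℕ) (a : Y d (n + 1) u),
    tr (n + 2) (incl d (n + 1) u a * g n (Nat.lt_succ_self (n + 1))) = z * tr (n + 1) a
  tr_t : ∀ (n : ℕ) (a : Y d n u) (s : ℕ), 1 ≤ s → s < d →
    tr (n + 1) (incl d n u a * t n (Nat.lt_succ_self n) ^ s) = x (s : ZMod d) * tr n a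

/-- The two-sided ideal of `Y_{d,n}(u)` generated by all the elements `c_{i,i+1}`. -/
def ctlIdeal (d n : ℕ) (u : ℂ) : TwoSidedIdeal (Y d n u) :=
  TwoSidedIdeal.span {a | ∃ (i : ℕ) (hi : i + 2 < n), a = cElem i hi}

/-- The Complex Reflection Temperley-Lieb algebra `CTL_{d,n}(u)`. -/
abbrev CTL (d n : ℕ) (u : ℂ) : Type := (ctlIdeal d n u).ringCon.Quotient

/-- The functional `φ` on `Y_{d,n}(u)` passes to the quotient algebra `CTL_{d,n}(u)`. -/
def PassesToCTL {d n : ℕ} {u : ℂ} (φ : Y d n u →ₗ[ℂ] ℂ) : Prop :=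
  ∃ ψ : CTL d n u →ₗ[ℂ] ℂ, ∀ a : Y d n u, ψ ((ctlIdeal d n u).ringCon.mk' a) = φ a

/-- `E^{(m)} = (1/d) ∑_s x_{m+s} x_{-s}`, the common value of the `tr (e_i^{(m)})`. -/
def E {d : ℕ} [NeZero d] (x : ZMod d → ℂ) (m : ZMod d) : ℂ :=
  (1 : ℂ) / (d : ℂ) * ∑ s : ZMod d, x (m + s) * x (-s)

/-- The E-condition: `E^{(m)} = x_m E` for `1 ≤ m ≤ d - 1`. -/
def ECondition {d : ℕ} [NeZero d] (x : ZMod d → ℂ) : Prop :=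
  ∀ m : ZMod d, m ≠ 0 → E x m = x m * E x 0

end YokonumaHecke

end

/-!
The Markov trace is a composite of conditional expectations `ε : Y_{d,n+1}(u) → Y_{d,n}(u)`, maps
of `Y_{d,n}(u)`-bimodules with `ε (a g_{n-1} b) = z a b` and `ε (a t_n^s) = x_s a`. To define `ε`,
let `Y_{d,n+1}(u)` act on `(n + 1) d` copies of `Y_{d,n}(u)`, labelled by the words
`g_k ⋯ g_{n-1} t_n^j`, by the formulas that express left multiplication in these words; apply an
element to the vector that stands for `1`, and close the last strand. Since the elements
`a g_{n-1} b` and `a t_n^s` span `Y_{d,n+1}(u)`, there is at most one trace. The composite is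
symmetric by induction on the number of strands: symmetry in the new generator `g_n` amounts to
self-adjointness of `a ↦ ε (g_n a g_n)` with respect to the trace already constructed.

For `u ≠ 0` the `g_i` are invertible, hence the `c_{i,i+1}` are conjugate to each other. The left
ideal of `Y_{d,3}(u)` generated by `c_{1,2}` is spanned by `c_{1,2}`, because the framing sums turn
the quadratic relation into that of the Hecke algebra. So the trace passes to the quotient if and
only if it vanishes on `c_{1,2}`, where its value is
`X ^ 3 + (u + 2) (d z) X ^ 2 + (u + 1) (d z) ^ 2 X` with `X = ∑ x_k`. This is `d ^ 2` times the
expression of the criterion, and it vanishes for `d z = -X`, whereas the E-condition with `X ≠ 0`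
would force `∑ x_k x_{-k} = X`.
-/

noncomputable section

namespace YokonumaHecke

section CyclicPowers

variable {d : ℕ} {M : Type*} [Monoid M] {a : M}

theorem pow_val_natCast (ha : a ^ d = 1) (m : ℕ) : a ^ (m : ZMod d).val = a ^ m := by
  rw [ZMod.val_natCast, ← pow_eq_pow_mod _ ha]

theorem pow_val_one (ha : a ^ d = 1) : a ^ (1 : ZMod d).val = a := by
  simpa only [Nat.cast_one, pow_one] using pow_val_natCast ha 1

theorem pow_val_add [NeZero d] (ha : a ^ d = 1) (k l : ZMod d) :
    a ^ (k + l).val = a ^ k.val * a ^ l.val := by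
  rw [ZMod.val_add, ← pow_eq_pow_mod _ ha, pow_add]

theorem pow_val_neg_natCast (ha : a ^ d = 1) {s : ℕ} (hs : s ≤ d) :
    a ^ (-(s : ZMod d)).val = a ^ (d - s) := by
  rw [← pow_val_natCast ha (d - s), Nat.cast_sub hs, ZMod.natCast_self, zero_sub]

theorem sum_range_natCast [NeZero d] {N : Type*} [AddCommMonoid N] (f : ZMod d → N) :
    ∑ s ∈ Finset.range d, f s = ∑ s, f s :=
  Finset.sum_bij' (fun s _ => (s : ZMod d)) (fun k _ => k.val) (by simp)
    (fun k _ => by simpa using ZMod.val_lt k)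
    (fun s hs => by simpa using ZMod.val_cast_of_lt (by simpa using hs)) (by simp) (by simp)

end CyclicPowers

section FramingAverages

variable {d : ℕ} {A : Type*} [Ring A] [Algebra ℂ A] {a b c : A}

theorem framingAverage_eq_sum_zmod [NeZero d] (ha : a ^ d = 1) (hb : b ^ d = 1) (m : ℕ) :
    framingAverage d m a b =
      (1 / d : ℂ) • ∑ s : ZMod d, a ^ ((m : ZMod d) + s).val * b ^ (-s).val := by
  rw [framingAverage, ← sum_range_natCast]
  congr 1
  refine Finset.sum_congr rfl fun s hs => ?_
  rw [pow_val_neg_natCast hb (Finset.mem_range.1 hs).le, ← Nat.cast_add, pow_val_natCast ha]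

theorem framingAverage_zero_eq_sum_zmod [NeZero d] (ha : a ^ d = 1) (hb : b ^ d = 1) :
    framingAverage d 0 a b = (1 / d : ℂ) • ∑ s : ZMod d, a ^ s.val * b ^ (-s).val := by
  simp only [framingAverage_eq_sum_zmod ha hb, Nat.cast_zero, zero_add]

theorem framingAverage_comm [NeZero d] (ha : a ^ d = 1) (hb : b ^ d = 1) (hab : Commute a b) :
    framingAverage d 0 a b = framingAverage d 0 b a := by
  rw [framingAverage_zero_eq_sum_zmod ha hb, framingAverage_zero_eq_sum_zmod hb ha,
    ← Equiv.sum_comp (Equiv.neg _)]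
  simp only [Equiv.neg_apply, neg_neg, (hab.pow_pow _ _).eq]

theorem semiconjBy_framingAverage {a' b' : A} (m : ℕ) (ha : SemiconjBy c a a')
    (hb : SemiconjBy c b b') :
    SemiconjBy c (framingAverage d m a b) (framingAverage d m a' b') := by
  simp only [SemiconjBy, framingAverage, mul_smul_comm, smul_mul_assoc, Finset.mul_sum,
    Finset.sum_mul, ((ha.pow_right _).mul_right (hb.pow_right _)).eq]

theorem commute_framingAverage (m : ℕ) (ha : Commute c a) (hb : Commute c b) :
    Commute c (framingAverage d m a b) :=
  semiconjBy_framingAverage m ha hb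

theorem framingAverage_mul_right [NeZero d] (ha : a ^ d = 1) (hb : b ^ d = 1)
    (hab : Commute a b) : framingAverage d 0 a b * b = framingAverage d 0 a b * a := by
  rw [framingAverage_zero_eq_sum_zmod ha hb, smul_mul_assoc, smul_mul_assoc, Finset.sum_mul,
    Finset.sum_mul, ← Equiv.sum_comp (Equiv.addRight (1 : ZMod d))]
  congr 1
  refine Finset.sum_congr rfl fun s _ => ?_
  have shift_b : b ^ (-(s + 1)).val * b = b ^ (-s).val := by
    conv_lhs => rhs; rw [← pow_val_one hb]
    rw [← pow_val_add hb, neg_add_rev, neg_add_cancel_comm]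
  rw [Equiv.coe_addRight, mul_assoc, shift_b, pow_val_add ha, pow_val_one ha, mul_assoc,
    mul_assoc, (hab.pow_right _).eq]

theorem framingAverage_mul_pow [NeZero d] (ha : a ^ d = 1) (hb : b ^ d = 1) (hab : Commute a b)
    (k : ℕ) : framingAverage d 0 a b * b ^ k = framingAverage d 0 a b * a ^ k := by
  induction k with
  | zero => simp only [pow_zero]
  | succ k ih =>
    rw [pow_succ, ← mul_assoc, ih, mul_assoc, (hab.pow_left k).eq, ← mul_assoc,
      framingAverage_mul_right ha hb hab, mul_assoc, ← pow_succ']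

theorem framingAverage_mul_framingAverage [NeZero d] (hb : b ^ d = 1) (hc : c ^ d = 1)
    (hbc : Commute b c) (hab : Commute a b) (hac : Commute a c) :
    framingAverage d 0 b c * framingAverage d 0 a c
      = framingAverage d 0 b c * framingAverage d 0 a b := by
  have pull_a (s : ℕ) :
      framingAverage d 0 b c * a ^ s = a ^ s * framingAverage d 0 b c :=
    ((commute_framingAverage 0 hab hac).pow_left s).eq.symm
  conv_lhs => rhs; rw [framingAverage]
  conv_rhs => rhs; rw [framingAverage]
  simp only [mul_smul_comm, Finset.mul_sum, ← mul_assoc, pull_a]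
  simp only [mul_assoc, framingAverage_mul_pow hb hc hbc]

theorem framingAverage_mul_self [NeZero d] (ha : a ^ d = 1) (hb : b ^ d = 1)
    (hab : Commute a b) :
    framingAverage d 0 a b * framingAverage d 0 a b = framingAverage d 0 a b := by
  have absorb : ∀ s ∈ Finset.range d,
      framingAverage d 0 a b * (a ^ (0 + s) * b ^ (d - s)) = framingAverage d 0 a b := by
    intro s hs
    rw [(hab.pow_pow _ _).eq, ← mul_assoc, framingAverage_mul_pow ha hb hab, mul_assoc,
      ← pow_add, zero_add, Nat.sub_add_cancel (Finset.mem_range.1 hs).le, ha, mul_one]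
  conv_lhs => rhs; rw [framingAverage]
  rw [mul_smul_comm, Finset.mul_sum, Finset.sum_congr rfl absorb, Finset.sum_const,
    Finset.card_range, ← Nat.cast_smul_eq_nsmul ℂ, smul_smul,
    one_div_mul_cancel (Nat.cast_ne_zero.2 (NeZero.ne d)), one_smul]

end FramingAverages

/-- `G` and `T` satisfy the defining relations of `Y_{d,n}(u)`. Families indexed by all of `ℕ`
avoid carrying index bounds; only `G i` with `i + 1 < n` and `T i` with `i < n` matter. -/
structure YokonumaFamily (d n : ℕ) (u : ℂ) {A : Type*} [Ring A] [Algebra ℂ A] (G T : ℕ → A) :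
    Prop where
  g_comm : ∀ i j, i + 1 < j → j + 1 < n → Commute (G i) (G j)
  braid : ∀ i, i + 2 < n → G (i + 1) * G i * G (i + 1) = G i * G (i + 1) * G i
  t_comm : ∀ i j, i < n → j < n → Commute (T i) (T j)
  t_pow : ∀ i, i < n → T i ^ d = 1
  g_t_left : ∀ i, i + 1 < n → SemiconjBy (G i) (T i) (T (i + 1))
  g_t_right : ∀ i, i + 1 < n → SemiconjBy (G i) (T (i + 1)) (T i)
  g_t_comm : ∀ i j, i + 1 < n → j < n → j ≠ i → j ≠ i + 1 → Commute (G i) (T j)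
  quadratic : ∀ i, i + 1 < n → G i * G i = 1 + (u - 1) • framingAverage d 0 (T i) (T (i + 1))
    + (u - 1) • (framingAverage d 0 (T i) (T (i + 1)) * G i)

namespace YokonumaFamily

variable {d n : ℕ} {u : ℂ} {A B : Type*} [Ring A] [Algebra ℂ A] [Ring B] [Algebra ℂ B]
  {G T : ℕ → A}

theorem map (h : YokonumaFamily d n u G T) (f : A →ₐ[ℂ] B) :
    YokonumaFamily d n u (fun i => f (G i)) (fun i => f (T i)) where
  g_comm i j hij hj := (h.g_comm i j hij hj).map f
  braid i hi := by simp only [← map_mul, h.braid i hi]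
  t_comm i j hi hj := (h.t_comm i j hi hj).map f
  t_pow i hi := by simp only [← map_pow, h.t_pow i hi, map_one]
  g_t_left i hi := (h.g_t_left i hi).map f
  g_t_right i hi := (h.g_t_right i hi).map f
  g_t_comm i j hi hj h1 h2 := (h.g_t_comm i j hi hj h1 h2).map f
  quadratic i hi := by
    simp only [← map_mul, h.quadratic i hi, ← map_framingAverage, map_add, map_smul, map_one]

/-- The values of a family on the generators. -/
def genMap (n : ℕ) (G T : ℕ → A) : Gen n → A
  | Gen.g i _ => G i
  | Gen.t j _ => T j

theorem lift_genMap_eq_of_rel (h : YokonumaFamily d n u G T) ⦃a b : FreeAlgebra ℂ (Gen n)⦄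
    (hr : Rel d n u a b) :
    FreeAlgebra.lift ℂ (genMap n G T) a = FreeAlgebra.lift ℂ (genMap n G T) b := by
  have lift_freeG (i : ℕ) (hi : i + 1 < n) :
      FreeAlgebra.lift ℂ (genMap n G T) (freeG i hi) = G i := by
    simp only [freeG, FreeAlgebra.lift_ι_apply, genMap]
  have lift_freeT (i : ℕ) (hi : i < n) :
      FreeAlgebra.lift ℂ (genMap n G T) (freeT i hi) = T i := by
    simp only [freeT, FreeAlgebra.lift_ι_apply, genMap]
  induction hr <;>
    simp only [map_mul, map_pow, map_add, map_one, map_smul, map_framingAverage, lift_freeG,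
      lift_freeT]
  case g_comm hi hj hij =>
    rcases hij with hij | hij
    · exact h.g_comm _ _ hij hj
    · exact (h.g_comm _ _ hij hi).symm
  case braid hi => exact h.braid _ hi
  case t_comm hi hj => exact h.t_comm _ _ hi hj
  case t_pow hi => exact h.t_pow _ hi
  case g_t_left hi _ => exact h.g_t_left _ hi
  case g_t_right hi _ => exact h.g_t_right _ hi
  case g_t_comm hi hj h1 h2 => exact h.g_t_comm _ _ hi hj h1 h2
  case quadratic hi _ => rw [pow_two]; exact h.quadratic _ hi

/-- The algebra map out of `Y_{d,n}(u)` determined by a family. -/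
def lift (h : YokonumaFamily d n u G T) : Y d n u →ₐ[ℂ] A :=
  RingQuot.liftAlgHom ℂ ⟨FreeAlgebra.lift ℂ (genMap n G T), h.lift_genMap_eq_of_rel⟩

@[simp] theorem lift_g (h : YokonumaFamily d n u G T) (i : ℕ) (hi : i + 1 < n) :
    h.lift (g i hi) = G i := by
  simp [lift, g, freeG, genMap]

@[simp] theorem lift_t (h : YokonumaFamily d n u G T) (i : ℕ) (hi : i < n) :
    h.lift (t i hi) = T i := by
  simp [lift, t, freeT, genMap]

end YokonumaFamily

section Generators

variable {d n : ℕ} {u : ℂ}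

/-- The generator `g_i` as a function of a bare index, with junk value `0` unless `i + 1 < n`. -/
def gGen (i : ℕ) : Y d n u := if hi : i + 1 < n then g i hi else 0

/-- The generator `t_i` as a function of a bare index, with junk value `0` unless `i < n`. -/
def tGen (i : ℕ) : Y d n u := if hi : i < n then t i hi else 0

theorem g_eq_gGen (i : ℕ) (hi : i + 1 < n) : (g i hi : Y d n u) = gGen i := by simp [gGen, hi]

theorem t_eq_tGen (i : ℕ) (hi : i < n) : (t i hi : Y d n u) = tGen i := by simp [tGen, hi]

theorem mk_freeG (i : ℕ) (hi : i + 1 < n) :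
    RingQuot.mkAlgHom ℂ (Rel d n u) (freeG i hi) = gGen i :=
  g_eq_gGen i hi

theorem mk_freeT (i : ℕ) (hi : i < n) :
    RingQuot.mkAlgHom ℂ (Rel d n u) (freeT i hi) = tGen i :=
  t_eq_tGen i hi

theorem yokonumaFamily_gen (d n : ℕ) (u : ℂ) :
    YokonumaFamily d n u (gGen : ℕ → Y d n u) tGen := by
  have mk_eq {a b} (h : Rel d n u a b) :
      RingQuot.mkAlgHom ℂ (Rel d n u) a = RingQuot.mkAlgHom ℂ (Rel d n u) b :=
    RingQuot.mkAlgHom_rel ℂ h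
  constructor
  case g_comm =>
    intro i j hij hj
    have hi : i + 1 < n := by omega
    simpa only [Commute, SemiconjBy, map_mul, mk_freeG] using
      mk_eq (Rel.g_comm i j hi hj (Or.inl hij))
  case braid =>
    intro i hi
    have hi' : i + 1 < n := by omega
    simpa only [map_mul, mk_freeG] using mk_eq (Rel.braid i hi' hi)
  case t_comm =>
    intro i j hi hj
    simpa only [Commute, SemiconjBy, map_mul, mk_freeT] using mk_eq (Rel.t_comm i j hi hj)
  case t_pow =>
    intro i hi
    simpa only [map_pow, map_one, mk_freeT] using mk_eq (Rel.t_pow i hi)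
  case g_t_left =>
    intro i hi
    have hi' : i < n := by omega
    simpa only [SemiconjBy, map_mul, mk_freeG, mk_freeT] using mk_eq (Rel.g_t_left i hi hi')
  case g_t_right =>
    intro i hi
    have hi' : i < n := by omega
    simpa only [SemiconjBy, map_mul, mk_freeG, mk_freeT] using mk_eq (Rel.g_t_right i hi hi')
  case g_t_comm =>
    intro i j hi hj h1 h2
    simpa only [Commute, SemiconjBy, map_mul, mk_freeG, mk_freeT] using
      mk_eq (Rel.g_t_comm i j hi hj h1 h2)
  case quadratic =>
    intro i hi
    have hi' : i < n := by omega
    have relation := mk_eq (Rel.quadratic i hi hi')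
    simpa only [map_add, map_one, map_smul, map_mul, map_framingAverage, pow_two, mk_freeG,
      mk_freeT] using relation

@[elab_as_elim]
theorem induction_mul {P : Y d n u → Prop} (one : P 1) (add : ∀ a b, P a → P b → P (a + b))
    (smul : ∀ (c : ℂ) a, P a → P (c • a))
    (g_mul : ∀ i, i + 1 < n → ∀ a, P a → P (gGen i * a))
    (t_mul : ∀ i, i < n → ∀ a, P a → P (tGen i * a)) (a : Y d n u) : P a := by
  obtain ⟨b, rfl⟩ := RingQuot.mkAlgHom_surjective ℂ (Rel d n u) a
  suffices ∀ y, P y → P (RingQuot.mkAlgHom ℂ (Rel d n u) b * y) by simpa using this 1 one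
  induction b using FreeAlgebra.induction with
  | grade0 r =>
    intro y hy
    rw [AlgHom.commutes, ← Algebra.smul_def]
    exact smul r y hy
  | grade1 x =>
    intro y hy
    cases x with
    | g i hi => exact (mk_freeG i hi).symm ▸ g_mul i hi y hy
    | t i hi => exact (mk_freeT i hi).symm ▸ t_mul i hi y hy
  | mul a b ha hb =>
    intro y hy
    rw [map_mul, mul_assoc]
    exact ha _ (hb _ hy)
  | add a b ha hb =>
    intro y hy
    rw [map_add, add_mul]
    exact add _ _ (ha _ hy) (hb _ hy)

theorem map_mul_comm_of_generators {φ : Y d n u →ₗ[ℂ] ℂ}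
    (g_comm : ∀ i, i + 1 < n → ∀ y, φ (gGen i * y) = φ (y * gGen i))
    (t_comm : ∀ i, i < n → ∀ y, φ (tGen i * y) = φ (y * tGen i)) (a b : Y d n u) :
    φ (a * b) = φ (b * a) := by
  induction a using induction_mul generalizing b with
  | one => rw [one_mul, mul_one]
  | add a a' ha ha' => rw [add_mul, mul_add, map_add, map_add, ha, ha']
  | smul c a ha => rw [smul_mul_assoc, mul_smul_comm, map_smul, map_smul, ha]
  | g_mul i hi a ha => rw [mul_assoc, g_comm i hi, mul_assoc, ha, mul_assoc]
  | t_mul i hi a ha => rw [mul_assoc, t_comm i hi, mul_assoc, ha, mul_assoc]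

theorem incl_gGen {i : ℕ} (hi : i + 1 < n) : incl d n u (gGen i) = gGen i := by
  rw [← g_eq_gGen i hi, ← g_eq_gGen i (Nat.lt_succ_of_lt hi)]
  simp [incl, g, freeG, inclGen]

theorem incl_tGen {i : ℕ} (hi : i < n) : incl d n u (tGen i) = tGen i := by
  rw [← t_eq_tGen i hi, ← t_eq_tGen i (Nat.lt_succ_of_lt hi)]
  simp [incl, t, freeT, inclGen]

end Generators

section InducedModule

/-- The algebra of diagonal operators on a power of a module. -/
def diagonalEnd (R ι N : Type*) [CommSemiring R] [AddCommMonoid N] [Module R N] :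
    (ι → Module.End R N) →ₐ[R] Module.End R (ι → N) :=
  AlgHom.ofLinearMap
    { toFun := fun f => LinearMap.piMap f
      map_add' := fun _ _ => rfl
      map_smul' := fun _ _ => rfl }
    rfl fun _ _ => rfl

@[simp] theorem diagonalEnd_apply {R ι N : Type*} [CommSemiring R] [AddCommMonoid N]
    [Module R N] (f : ι → Module.End R N) (v : ι → N) (k : ι) :
    diagonalEnd R ι N f v k = f k (v k) := rfl

theorem semiconjBy_apply {R N : Type*} [Semiring R] [AddCommMonoid N] [Module R N]
    {a x y : Module.End R N} (h : SemiconjBy a x y) (w : N) : a (x w) = y (a w) :=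
  LinearMap.congr_fun h.eq w

variable {d n : ℕ} {u : ℂ} {N : Type*} [AddCommGroup N] [Module ℂ N]
  {G T p : ℕ → Module.End ℂ N} {τ : Module.End ℂ N}

/-- The `k`-th diagonal entry of the action of `t_i` on the induced module. -/
def indTEntry (T : ℕ → Module.End ℂ N) (τ : Module.End ℂ N) (i k : ℕ) : Module.End ℂ N :=
  if k < i then T (i - 1) else if k = i then τ else T i

/-- The action of `t_i` on the module induced from `n` to `n + 1` strands. The `k`-th summand
belongs to the coset of `g_k ⋯ g_{n-1}`, and `τ` is the framing of the new strand, which this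
coset representative moves to position `k`. -/
def indT (n : ℕ) (T : ℕ → Module.End ℂ N) (τ : Module.End ℂ N) (i : ℕ) :
    Module.End ℂ (Fin (n + 1) → N) :=
  diagonalEnd ℂ (Fin (n + 1)) N fun k => indTEntry T τ i k

/-- The action of `g_i` on the module induced from `n` to `n + 1` strands, where `p i` stands for
the average `e` of the framing `T i` and the framing of the new strand. The values
of `Fin.ofNat` are meant for `i < n`, where no reduction modulo `n + 1` occurs. -/
def indG (n : ℕ) (u : ℂ) (G p : ℕ → Module.End ℂ N) (i : ℕ) :
    Module.End ℂ (Fin (n + 1) → N) where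
  toFun v k :=
    if k.val < i then G (i - 1) (v k)
    else if k.val = i then v (Fin.ofNat (n + 1) (i + 1)) + (u - 1) • p i (v k)
    else if k.val = i + 1 then v (Fin.ofNat (n + 1) i) + (u - 1) • p i (v (Fin.ofNat (n + 1) i))
    else G i (v k)
  map_add' v w := by
    ext k
    simp only [Pi.add_apply, map_add, smul_add]
    split_ifs <;> abel
  map_smul' c v := by
    ext k
    simp only [Pi.smul_apply, map_smul, RingHom.id_apply]
    split_ifs <;> module

theorem indTEntry_of_lt {i k : ℕ} (h : k < i) : indTEntry T τ i k = T (i - 1) := if_pos h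

theorem indTEntry_self (i : ℕ) : indTEntry T τ i i = τ := by simp [indTEntry]

theorem indTEntry_of_gt {i k : ℕ} (h : i < k) : indTEntry T τ i k = T i := by
  simp [indTEntry, h.not_gt, h.ne']

theorem indT_apply (i : ℕ) (v : Fin (n + 1) → N) (k : Fin (n + 1)) :
    indT n T τ i v k = indTEntry T τ i k (v k) := rfl

theorem framingAverage_indT_apply (i j : ℕ) (v : Fin (n + 1) → N) (k : Fin (n + 1)) :
    framingAverage d 0 (indT n T τ i) (indT n T τ j) v k
      = framingAverage d 0 (indTEntry T τ i k) (indTEntry T τ j k) (v k) := by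
  rw [indT, indT, ← map_framingAverage, diagonalEnd_apply]
  exact LinearMap.congr_fun (map_framingAverage d
    (Pi.evalAlgHom ℂ (fun _ : Fin (n + 1) => Module.End ℂ N) k) 0 _ _) (v k)

theorem indG_apply_of_lt {i k : ℕ} (hk : k < n + 1) (h : k < i) (v : Fin (n + 1) → N) :
    indG n u G p i v ⟨k, hk⟩ = G (i - 1) (v ⟨k, hk⟩) :=
  if_pos h

theorem indG_apply_self {i : ℕ} (hi : i < n) (hk : i < n + 1) (v : Fin (n + 1) → N) :
    indG n u G p i v ⟨i, hk⟩
      = v ⟨i + 1, Nat.succ_lt_succ hi⟩ + (u - 1) • p i (v ⟨i, hk⟩) := by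
  simp [indG, Fin.ofNat, Nat.mod_eq_of_lt (Nat.succ_lt_succ hi)]

theorem indG_apply_succ {i : ℕ} (hk : i + 1 < n + 1) (v : Fin (n + 1) → N) :
    indG n u G p i v ⟨i + 1, hk⟩
      = v ⟨i, Nat.lt_of_succ_lt hk⟩ + (u - 1) • p i (v ⟨i, Nat.lt_of_succ_lt hk⟩) := by
  simp [indG, Fin.ofNat, Nat.mod_eq_of_lt (Nat.lt_of_succ_lt hk)]

theorem indG_apply_of_gt {i k : ℕ} (hk : k < n + 1) (h : i + 1 < k) (v : Fin (n + 1) → N) :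
    indG n u G p i v ⟨k, hk⟩ = G i (v ⟨k, hk⟩) := by
  simp [indG, (Nat.lt_of_succ_lt h).not_gt, (Nat.lt_of_succ_lt h).ne', h.ne']

theorem semiconjBy_indG_diagonalEnd {i : ℕ} (hi : i < n) {δ δ' : ℕ → Module.End ℂ N}
    (h_lt : ∀ k < i, SemiconjBy (G (i - 1)) (δ k) (δ' k))
    (h_gt : ∀ k, i + 1 < k → k < n + 1 → SemiconjBy (G i) (δ k) (δ' k))
    (h_swap : δ (i + 1) = δ' i) (h_swap' : δ i = δ' (i + 1))
    (hp : SemiconjBy (p i) (δ i) (δ' i)) (hp' : Commute (p i) (δ i)) :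
    SemiconjBy (indG n u G p i) (diagonalEnd ℂ (Fin (n + 1)) N fun k => δ k)
      (diagonalEnd ℂ (Fin (n + 1)) N fun k => δ' k) := by
  refine LinearMap.ext fun v => funext fun ⟨k, hk⟩ => ?_
  simp only [Module.End.mul_apply, diagonalEnd_apply]
  obtain h | rfl | rfl | h : k < i ∨ k = i ∨ k = i + 1 ∨ i + 1 < k := by omega
  · simp only [indG_apply_of_lt hk h, diagonalEnd_apply, semiconjBy_apply (h_lt k h)]
  · simp only [indG_apply_self hi, diagonalEnd_apply, semiconjBy_apply hp, h_swap, map_add,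
      map_smul]
  · simp only [indG_apply_succ, diagonalEnd_apply, map_add, map_smul, semiconjBy_apply hp',
      ← h_swap']
  · simp only [indG_apply_of_gt hk h, diagonalEnd_apply, semiconjBy_apply (h_gt k h hk)]

theorem commute_indG {i j : ℕ} (hij : i + 1 < j) (hj : j < n)
    (hG : ∀ a b, a + 1 < b → b + 1 < n → Commute (G a) (G b))
    (hGp : ∀ a b, a + 1 < n → b < n → b ≠ a → b ≠ a + 1 → Commute (G a) (p b)) :
    Commute (indG n u G p i) (indG n u G p j) := by
  have hi : i < n := by omega
  refine LinearMap.ext fun v => funext fun ⟨k, hk⟩ => ?_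
  simp only [Module.End.mul_apply]
  have G_p := semiconjBy_apply (hGp (j - 1) i (by omega) hi (by omega) (by omega))
  have G_p' := semiconjBy_apply (hGp i j (by omega) hj (by omega) (by omega))
  obtain h | rfl | rfl | h : k < i ∨ k = i ∨ k = i + 1 ∨ i + 1 < k := by omega
  · have h' : k < j := by omega
    simp only [indG_apply_of_lt hk h, indG_apply_of_lt hk h',
      semiconjBy_apply (hG (i - 1) (j - 1) (by omega) (by omega))]
  · have h' : k < j := by omega
    simp only [indG_apply_self hi, indG_apply_of_lt _ h', indG_apply_of_lt _ hij, map_add, map_smul,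
      G_p]
  · have h' : i < j := by omega
    simp only [indG_apply_succ, indG_apply_of_lt _ h', indG_apply_of_lt _ hij, map_add, map_smul,
      G_p]
  obtain h' | rfl | rfl | h' : k < j ∨ k = j ∨ k = j + 1 ∨ j + 1 < k := by omega
  · simp only [indG_apply_of_gt hk h, indG_apply_of_lt hk h',
      semiconjBy_apply (hG i (j - 1) (by omega) (by omega))]
  · have h' : i + 1 < k + 1 := by omega
    simp only [indG_apply_of_gt _ h, indG_apply_self hj, indG_apply_of_gt _ h', map_add, map_smul,
      G_p']
  · simp only [indG_apply_of_gt _ h, indG_apply_succ, indG_apply_of_gt _ hij, map_add, map_smul,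
      G_p']
  · simp only [indG_apply_of_gt hk h, indG_apply_of_gt hk h',
      semiconjBy_apply (hG i j hij (by omega))]

theorem indG_braid {ε : Module.End ℂ N} {i : ℕ} (hi : i + 1 < n)
    (hG : ∀ j, j + 2 < n → G (j + 1) * G j * G (j + 1) = G j * G (j + 1) * G j)
    (hGG : G i * G i = 1 + (u - 1) • ε + (u - 1) • (ε * G i))
    (hGp : SemiconjBy (G i) (p i) (p (i + 1))) (hGp' : SemiconjBy (G i) (p (i + 1)) (p i))
    (hpp : Commute (p i) (p (i + 1))) (hpε : p (i + 1) * ε = p (i + 1) * p i) :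
    indG n u G p (i + 1) * indG n u G p i * indG n u G p (i + 1)
      = indG n u G p i * indG n u G p (i + 1) * indG n u G p i := by
  have hi' : i < n := by omega
  have G_braid (j : ℕ) (hj : j + 2 < n) (w : N) :
      G (j + 1) (G j (G (j + 1) w)) = G j (G (j + 1) (G j w)) :=
    LinearMap.congr_fun (hG j hj) w
  have G_sq (w : N) : G i (G i w) = w + (u - 1) • ε w + (u - 1) • ε (G i w) :=
    LinearMap.congr_fun hGG w
  have p_ε (w : N) : p (i + 1) (ε w) = p (i + 1) (p i w) := LinearMap.congr_fun hpε w
  have G_p := semiconjBy_apply hGp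
  have G_p' := semiconjBy_apply hGp'
  have p_p := semiconjBy_apply hpp
  refine LinearMap.ext fun v => funext fun ⟨k, hk⟩ => ?_
  simp only [Module.End.mul_apply]
  obtain h | rfl | rfl | rfl | h :
    k < i ∨ k = i ∨ k = i + 1 ∨ k = i + 2 ∨ i + 2 < k := by omega
  · simp only [indG_apply_of_lt hk h, indG_apply_of_lt hk (Nat.lt_succ_of_lt h)]
    obtain ⟨j, rfl⟩ : ∃ j, i = j + 1 := ⟨i - 1, by omega⟩
    exact G_braid j hi _
  · simp only [indG_apply_of_lt _ (Nat.lt_add_one _), indG_apply_self hi, indG_apply_self hi',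
      Nat.add_sub_cancel, indG_apply_succ, indG_apply_of_gt _ (Nat.lt_add_one _), map_add,
      map_smul, G_p, G_p', G_sq, p_ε, p_p]
    module
  · simp only [indG_apply_of_lt _ (Nat.lt_add_one _), indG_apply_self hi, indG_apply_self hi',
      Nat.add_sub_cancel, indG_apply_succ, indG_apply_of_gt _ (Nat.lt_add_one _), map_add,
      map_smul, G_p, G_p', p_p]
    module
  · simp only [indG_apply_of_lt _ (Nat.lt_add_one _), Nat.add_sub_cancel, indG_apply_succ,
      indG_apply_of_gt _ (Nat.lt_add_one _), map_add, map_smul, G_p, G_p', p_p]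
    module
  · simp only [indG_apply_of_gt hk h, indG_apply_of_gt hk (Nat.lt_of_succ_lt h)]
    exact G_braid i (by omega) _

end InducedModule

section InducedFamily

variable {d n : ℕ} {u : ℂ} {N : Type*} [AddCommGroup N] [Module ℂ N]
  {G T : ℕ → Module.End ℂ N} {τ c : Module.End ℂ N}

/-- `τ` can serve as the framing of an additional strand: it has order dividing `d` and commutes
with the operators of a family on `n` strands. -/
structure IsNewFraming (d n : ℕ) {A : Type*} [Monoid A] (G T : ℕ → A) (τ : A) : Prop where
  pow : τ ^ d = 1
  comm_g : ∀ i, i + 1 < n → Commute (G i) τ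
  comm_t : ∀ i, i < n → Commute (T i) τ

/-- The average `e` of the framing `T i` and the framing `τ` of the new strand. -/
def newStrandAverage (d : ℕ) {A : Type*} [Ring A] [Algebra ℂ A] (T : ℕ → A) (τ : A) (i : ℕ) : A :=
  framingAverage d 0 (T i) τ

theorem indTEntry_pow (h : YokonumaFamily d n u G T) (hτ : IsNewFraming d n G T τ) {i k : ℕ}
    (hi : i < n + 1) (hk : k < n + 1) : indTEntry T τ i k ^ d = 1 := by
  unfold indTEntry
  split_ifs
  exacts [h.t_pow _ (by omega), hτ.pow, h.t_pow _ (by omega)]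

theorem commute_indTEntry_right (hT : ∀ i < n, Commute c (T i)) (hc : Commute c τ) {i k : ℕ}
    (hi : i < n + 1) (hk : k < n + 1) : Commute c (indTEntry T τ i k) := by
  unfold indTEntry
  split_ifs
  exacts [hT _ (by omega), hc, hT _ (by omega)]

theorem commute_indTEntry (h : YokonumaFamily d n u G T) (hτ : IsNewFraming d n G T τ)
    {i j k l : ℕ} (hi : i < n + 1) (hj : j < n + 1) (hk : k < n + 1) (hl : l < n + 1) :
    Commute (indTEntry T τ i k) (indTEntry T τ j l) :=
  commute_indTEntry_right
    (fun m hm => (commute_indTEntry_right (fun m' => h.t_comm m m' hm) (hτ.comm_t m hm) hi hk).symm)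
    (commute_indTEntry_right (fun m hm => (hτ.comm_t m hm).symm) (Commute.refl τ) hi hk).symm hj hl

theorem indG_quadratic [NeZero d] (h : YokonumaFamily d n u G T) (hτ : IsNewFraming d n G T τ)
    {i : ℕ} (hi : i < n) :
    indG n u G (newStrandAverage d T τ) i * indG n u G (newStrandAverage d T τ) i
      = 1 + (u - 1) • framingAverage d 0 (indT n T τ i) (indT n T τ (i + 1))
        + (u - 1) • (framingAverage d 0 (indT n T τ i) (indT n T τ (i + 1))
          * indG n u G (newStrandAverage d T τ) i) := by
  refine LinearMap.ext fun v => funext fun ⟨k, hk⟩ => ?_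
  simp only [Module.End.mul_apply, LinearMap.add_apply, LinearMap.smul_apply, Pi.add_apply,
    Pi.smul_apply, framingAverage_indT_apply, Module.End.one_apply]
  obtain h1 | rfl | rfl | h1 : k < i ∨ k = i ∨ k = i + 1 ∨ i + 1 < k := by omega
  · simp only [indG_apply_of_lt hk h1, indTEntry_of_lt h1, indTEntry_of_lt (Nat.lt_succ_of_lt h1)]
    obtain ⟨i, rfl⟩ : ∃ j, i = j + 1 := ⟨i - 1, by omega⟩
    exact LinearMap.congr_fun (h.quadratic i hi) (v ⟨k, hk⟩)
  · simp only [indTEntry_self, indTEntry_of_lt (Nat.lt_add_one _), Nat.add_sub_cancel,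
      framingAverage_comm hτ.pow (h.t_pow k hi) (hτ.comm_t k hi).symm, indG_apply_self hi,
      indG_apply_succ, newStrandAverage]
  · simp only [indTEntry_self, indTEntry_of_gt (Nat.lt_add_one _), indG_apply_self hi,
      indG_apply_succ, newStrandAverage, map_add, map_smul]
    module
  · simp only [indTEntry_of_gt h1, indTEntry_of_gt (Nat.lt_of_succ_lt h1), indG_apply_of_gt hk h1]
    exact LinearMap.congr_fun (h.quadratic i (by omega)) (v ⟨k, hk⟩)

theorem commute_newStrandAverage (h : YokonumaFamily d n u G T) (hτ : IsNewFraming d n G T τ)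
    {i j k : ℕ} (hi : i < n) (hj : j < n + 1) (hk : k < n + 1) :
    Commute (newStrandAverage d T τ i) (indTEntry T τ j k) :=
  (commute_framingAverage 0
    (commute_indTEntry_right (fun m => h.t_comm i m hi) (hτ.comm_t i hi) hj hk).symm
    (commute_indTEntry_right (fun m hm => (hτ.comm_t m hm).symm) (Commute.refl τ) hj hk).symm).symm

theorem newStrandAverage_mul_framing [NeZero d] (h : YokonumaFamily d n u G T)
    (hτ : IsNewFraming d n G T τ) {i : ℕ} (hi : i < n) :
    newStrandAverage d T τ i * τ = newStrandAverage d T τ i * T i :=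
  framingAverage_mul_right (h.t_pow i hi) hτ.pow (hτ.comm_t i hi)

theorem semiconjBy_indG_indT_self [NeZero d] (h : YokonumaFamily d n u G T)
    (hτ : IsNewFraming d n G T τ) {i : ℕ} (hi : i < n) :
    SemiconjBy (indG n u G (newStrandAverage d T τ) i) (indT n T τ i) (indT n T τ (i + 1)) := by
  have entry_self : indTEntry T τ i i = τ := indTEntry_self i
  have entry_succ : indTEntry T τ (i + 1) i = T i := indTEntry_of_lt (Nat.lt_add_one i)
  have commute_entry {j : ℕ} (hj : j < n + 1) :=
    commute_newStrandAverage h hτ hi hj (Nat.lt_succ_of_lt hi)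
  refine semiconjBy_indG_diagonalEnd hi (fun k hk => ?_) (fun k hk hk' => ?_) ?_ ?_ ?_
    (commute_entry (Nat.lt_succ_of_lt hi))
  · obtain ⟨i, rfl⟩ : ∃ j, i = j + 1 := ⟨i - 1, by omega⟩
    rw [indTEntry_of_lt hk, indTEntry_of_lt (Nat.lt_succ_of_lt hk)]
    exact h.g_t_left i hi
  · rw [indTEntry_of_gt hk, indTEntry_of_gt (Nat.lt_of_succ_lt hk)]
    exact h.g_t_left i (by omega)
  · rw [entry_succ, indTEntry_of_gt (Nat.lt_add_one i)]
  · rw [entry_self, indTEntry_self]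
  · have := commute_entry (Nat.succ_lt_succ hi)
    rw [entry_succ] at this
    rw [entry_self, entry_succ]
    exact (newStrandAverage_mul_framing h hτ hi).trans this.eq

theorem semiconjBy_indG_indT_succ [NeZero d] (h : YokonumaFamily d n u G T)
    (hτ : IsNewFraming d n G T τ) {i : ℕ} (hi : i < n) :
    SemiconjBy (indG n u G (newStrandAverage d T τ) i) (indT n T τ (i + 1)) (indT n T τ i) := by
  have entry_self : indTEntry T τ i i = τ := indTEntry_self i
  have entry_succ : indTEntry T τ (i + 1) i = T i := indTEntry_of_lt (Nat.lt_add_one i)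
  have commute_entry {j : ℕ} (hj : j < n + 1) :=
    commute_newStrandAverage h hτ hi hj (Nat.lt_succ_of_lt hi)
  refine semiconjBy_indG_diagonalEnd hi (fun k hk => ?_) (fun k hk hk' => ?_) ?_ ?_ ?_
    (commute_entry (Nat.succ_lt_succ hi))
  · obtain ⟨i, rfl⟩ : ∃ j, i = j + 1 := ⟨i - 1, by omega⟩
    rw [indTEntry_of_lt hk, indTEntry_of_lt (Nat.lt_succ_of_lt hk)]
    exact h.g_t_right i hi
  · rw [indTEntry_of_gt hk, indTEntry_of_gt (Nat.lt_of_succ_lt hk)]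
    exact h.g_t_right i (by omega)
  · rw [entry_self, indTEntry_self]
  · rw [entry_succ, indTEntry_of_gt (Nat.lt_add_one i)]
  · have := commute_entry (Nat.lt_succ_of_lt hi)
    rw [entry_self] at this
    rw [entry_self, entry_succ]
    exact (newStrandAverage_mul_framing h hτ hi).symm.trans this.eq

theorem commute_indG_indT (h : YokonumaFamily d n u G T) (hτ : IsNewFraming d n G T τ)
    {i j : ℕ} (hi : i < n) (hj : j < n + 1) (hji : j ≠ i) (hji' : j ≠ i + 1) :
    Commute (indG n u G (newStrandAverage d T τ) i) (indT n T τ j) := by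
  have same_entry : indTEntry T τ j (i + 1) = indTEntry T τ j i := by
    unfold indTEntry
    split_ifs <;> first | rfl | omega
  have p_entry := commute_newStrandAverage h hτ hi hj (Nat.lt_succ_of_lt hi)
  refine semiconjBy_indG_diagonalEnd hi (fun k hk => ?_) (fun k hk hk' => ?_) same_entry
    same_entry.symm p_entry p_entry
  · unfold indTEntry
    split_ifs
    exacts [h.g_t_comm _ _ (by omega) (by omega) (by omega) (by omega), hτ.comm_g _ (by omega),
      h.g_t_comm _ _ (by omega) (by omega) (by omega) (by omega)]
  · unfold indTEntry
    split_ifs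
    exacts [h.g_t_comm _ _ (by omega) (by omega) (by omega) (by omega), hτ.comm_g _ (by omega),
      h.g_t_comm _ _ (by omega) (by omega) (by omega) (by omega)]

theorem YokonumaFamily.induced [NeZero d] (h : YokonumaFamily d n u G T)
    (hτ : IsNewFraming d n G T τ) :
    YokonumaFamily d (n + 1) u (indG n u G (newStrandAverage d T τ)) (indT n T τ) where
  g_comm i j hij hj := commute_indG hij (by omega) h.g_comm fun a b ha hb hne hne' =>
    commute_framingAverage 0 (h.g_t_comm a b ha hb hne hne') (hτ.comm_g a ha)
  braid i hi := by
    have hi' : i + 1 < n := by omega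
    have hT := h.t_comm i (i + 1) (by omega) hi'
    have hτ₀ := hτ.comm_t i (by omega)
    have hτ₁ := hτ.comm_t (i + 1) hi'
    exact indG_braid hi' h.braid (h.quadratic i hi')
      (semiconjBy_framingAverage 0 (h.g_t_left i hi') (hτ.comm_g i hi'))
      (semiconjBy_framingAverage 0 (h.g_t_right i hi') (hτ.comm_g i hi'))
      (commute_framingAverage 0
        (commute_framingAverage 0 hT.symm hτ₁).symm
        (commute_framingAverage 0 hτ₀.symm (Commute.refl τ)).symm)
      (framingAverage_mul_framingAverage (h.t_pow _ hi') hτ.pow hτ₁ hT hτ₀).symm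
  t_comm i j hi hj := by
    rw [indT, indT, Commute, SemiconjBy, ← map_mul, ← map_mul]
    exact congrArg _ (funext fun k => commute_indTEntry h hτ hi hj k.2 k.2)
  t_pow i hi := by
    rw [indT, ← map_pow, ← map_one (diagonalEnd ℂ (Fin (n + 1)) N)]
    exact congrArg _ (funext fun k => indTEntry_pow h hτ hi k.2)
  g_t_left i hi := semiconjBy_indG_indT_self h hτ (by omega)
  g_t_right i hi := semiconjBy_indG_indT_succ h hτ (by omega)
  g_t_comm i j hi hj hji hji' := commute_indG_indT h hτ (by omega) hj hji hji'
  quadratic i hi := indG_quadratic h hτ (by omega)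

theorem commute_indT_diagonalEnd (hT : ∀ i < n, Commute c (T i)) (hc : Commute c τ) {i : ℕ}
    (hi : i < n + 1) :
    Commute (indT n T τ i) (diagonalEnd ℂ (Fin (n + 1)) N fun _ => c) := by
  rw [indT, Commute, SemiconjBy, ← map_mul, ← map_mul]
  exact congrArg _ (funext fun k => (commute_indTEntry_right hT hc hi k.2).symm)

theorem commute_indG_diagonalEnd (hG : ∀ i, i + 1 < n → Commute c (G i))
    (hT : ∀ i < n, Commute c (T i)) (hc : Commute c τ) {i : ℕ} (hi : i < n) :
    Commute (indG n u G (newStrandAverage d T τ) i)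
      (diagonalEnd ℂ (Fin (n + 1)) N fun _ => c) :=
  have hp : Commute (newStrandAverage d T τ i) c := (commute_framingAverage 0 (hT i hi) hc).symm
  semiconjBy_indG_diagonalEnd hi (fun k hk => (hG (i - 1) (by omega)).symm)
    (fun k hk hk' => (hG i (by omega)).symm) rfl rfl hp hp

end InducedFamily

/-- The product `G_k G_{k+1} ⋯ G_{k+m-1}`. -/
def ascendingProd {M : Type*} [Monoid M] (G : ℕ → M) : ℕ → ℕ → M
  | _, 0 => 1
  | k, m + 1 => G k * ascendingProd G (k + 1) m

namespace YokonumaFamily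

variable {d n : ℕ} {u : ℂ} {A : Type*} [Ring A] [Algebra ℂ A] {G T : ℕ → A}

theorem commute_ascendingProd_g (h : YokonumaFamily d n u G T) {i k m : ℕ} (hkm : k + m < n)
    (hi : i + 1 < k) : Commute (G i) (ascendingProd G k m) := by
  induction m generalizing k with
  | zero => exact Commute.one_right _
  | succ m ih =>
    exact (h.g_comm i k (by omega) (by omega)).mul_right (ih (by omega) (by omega))

theorem semiconjBy_ascendingProd_g (h : YokonumaFamily d n u G T) {i k m : ℕ} (hkm : k + m < n)
    (hki : k ≤ i) (hi : i + 1 < k + m) :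
    SemiconjBy (ascendingProd G k m) (G i) (G (i + 1)) := by
  induction m generalizing k with
  | zero => omega
  | succ m ih =>
    rcases hki.eq_or_lt with rfl | hki
    · obtain ⟨m, rfl⟩ : ∃ m', m = m' + 1 := ⟨m - 1, by omega⟩
      have braid : SemiconjBy (G k * G (k + 1)) (G k) (G (k + 1)) := by
        simpa only [SemiconjBy, mul_assoc] using (h.braid k (by omega)).symm
      have tail : Commute (ascendingProd G (k + 2) m) (G k) :=
        (h.commute_ascendingProd_g (by omega) (by omega)).symm
      simpa only [ascendingProd, mul_assoc] using braid.mul_left tail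
    · exact SemiconjBy.mul_left (h.g_comm k (i + 1) (by omega) (by omega))
        (ih (by omega) (by omega) (by omega))

theorem commute_ascendingProd_t (h : YokonumaFamily d n u G T) {i k m : ℕ} (hkm : k + m < n)
    (hi : i < k) : Commute (T i) (ascendingProd G k m) := by
  induction m generalizing k with
  | zero => exact Commute.one_right _
  | succ m ih =>
    exact (h.g_t_comm k i (by omega) (by omega) (by omega) (by omega)).symm.mul_right
      (ih (by omega) (by omega))

theorem semiconjBy_ascendingProd_t_last (h : YokonumaFamily d n u G T) {k m : ℕ} (hkm : k + m < n) :
    SemiconjBy (ascendingProd G k m) (T (k + m)) (T k) := by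
  induction m generalizing k with
  | zero => exact SemiconjBy.one_left _
  | succ m ih =>
    have tail := ih (k := k + 1) (by omega)
    rw [Nat.succ_add_eq_add_succ] at tail
    exact (h.g_t_right k (by omega)).mul_left tail

theorem semiconjBy_ascendingProd_t (h : YokonumaFamily d n u G T) {i k m : ℕ} (hkm : k + m < n)
    (hki : k ≤ i) (hi : i < k + m) : SemiconjBy (ascendingProd G k m) (T i) (T (i + 1)) := by
  induction m generalizing k with
  | zero => omega
  | succ m ih =>
    rcases hki.eq_or_lt with rfl | hki
    · exact (h.g_t_left k (by omega)).mul_left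
        (h.commute_ascendingProd_t (by omega) (by omega)).symm
    · exact SemiconjBy.mul_left
        (h.g_t_comm k (i + 1) (by omega) (by omega) (by omega) (by omega))
        (ih (by omega) (by omega) (by omega))

end YokonumaFamily

section SingleSummand

theorem single_last_of_lt {n : ℕ} {N : Type*} [Zero N] {k : ℕ} (hk : k < n) (w : N) :
    (Pi.single (Fin.last n) w : Fin (n + 1) → N) ⟨k, Nat.lt_succ_of_lt hk⟩ = 0 := by
  simp [Fin.ext_iff, hk.ne]

variable {n : ℕ} {u : ℂ} {N : Type*} [AddCommGroup N] [Module ℂ N]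
  {G T p : ℕ → Module.End ℂ N} {τ : Module.End ℂ N}

theorem diagonalEnd_single {R ι N : Type*} [CommSemiring R] [AddCommMonoid N] [Module R N]
    [DecidableEq ι] (f : ι → Module.End R N) (k : ι) (w : N) :
    diagonalEnd R ι N f (Pi.single k w) = Pi.single k (f k w) :=
  funext fun l => Pi.apply_single (fun i => f i) (fun i => map_zero (f i)) k w l

theorem indT_single_last_of_lt {i : ℕ} (hi : i < n) (w : N) :
    indT n T τ i (Pi.single (Fin.last n) w) = Pi.single (Fin.last n) (T i w) := by
  rw [indT, diagonalEnd_single, Fin.val_last, indTEntry_of_gt hi]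

theorem indT_single_last_self (w : N) :
    indT n T τ n (Pi.single (Fin.last n) w) = Pi.single (Fin.last n) (τ w) := by
  rw [indT, diagonalEnd_single, Fin.val_last, indTEntry_self]

theorem indG_single_last_of_lt {i : ℕ} (hi : i + 1 < n) (w : N) :
    indG n u G p i (Pi.single (Fin.last n) w) = Pi.single (Fin.last n) (G i w) := by
  have hi' : i < n := by omega
  refine funext fun ⟨k, hk⟩ => ?_
  obtain h | rfl | rfl | h : k < i ∨ k = i ∨ k = i + 1 ∨ i + 1 < k := by omega
  · have hkn : k < n := by omega
    rw [indG_apply_of_lt hk h, single_last_of_lt hkn, single_last_of_lt hkn, map_zero]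
  · rw [indG_apply_self hi', single_last_of_lt hi', single_last_of_lt hi', single_last_of_lt hi,
      map_zero, smul_zero, add_zero]
  · rw [indG_apply_succ, single_last_of_lt hi', single_last_of_lt hi, map_zero, smul_zero,
      add_zero]
  · rw [indG_apply_of_gt hk h]
    exact Pi.apply_single (fun _ => G i) (fun _ => map_zero (G i)) (Fin.last n) w ⟨k, hk⟩

theorem indG_single_last_self (w : N) :
    indG (n + 1) u G p n (Pi.single (Fin.last (n + 1)) w)
      = Pi.single (Fin.castSucc (Fin.last n)) w := by
  refine funext fun ⟨k, hk⟩ => ?_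
  have single_castSucc_of_ne (hkn : k ≠ n) :
      (Pi.single (Fin.castSucc (Fin.last n)) w : Fin (n + 1 + 1) → N) ⟨k, hk⟩ = 0 := by
    simp [Fin.ext_iff, hkn]
  obtain h | rfl | rfl : k < n ∨ k = n ∨ k = n + 1 := by omega
  · rw [indG_apply_of_lt hk h, single_last_of_lt (Nat.lt_succ_of_lt h), map_zero,
      single_castSucc_of_ne h.ne]
  · rw [indG_apply_self k.lt_succ_self, single_last_of_lt k.lt_succ_self, map_zero, smul_zero,
      add_zero]
    simp [Pi.single_apply, Fin.ext_iff]
  · rw [indG_apply_succ, single_last_of_lt n.lt_succ_self, map_zero, smul_zero, add_zero,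
      single_castSucc_of_ne n.succ_ne_self]

end SingleSummand

section InducedRepresentation

variable {d n : ℕ} {u : ℂ}

/-- Pointwise left multiplication on the functions `ZMod d → Y_{d,n}(u)`. -/
abbrev leftAction (d n : ℕ) (u : ℂ) : Y d n u →ₐ[ℂ] Module.End ℂ (ZMod d → Y d n u) :=
  Algebra.lsmul ℂ ℂ (ZMod d → Y d n u)

/-- Pointwise right multiplication on the functions `ZMod d → Y_{d,n}(u)`. -/
def rightAction (a : Y d n u) : Module.End ℂ (ZMod d → Y d n u) :=
  (LinearMap.mulRight ℂ a).compLeft (ZMod d)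

/-- The shift on the functions `ZMod d → Y_{d,n}(u)`, by which the framing of a new strand acts. -/
def shift (d n : ℕ) (u : ℂ) : Module.End ℂ (ZMod d → Y d n u) :=
  LinearMap.funLeft ℂ (Y d n u) fun j => j - 1

theorem rightAction_apply (a : Y d n u) (f : ZMod d → Y d n u) (j : ZMod d) :
    rightAction a f j = f j * a := rfl

theorem shift_apply (f : ZMod d → Y d n u) (j : ZMod d) : shift d n u f j = f (j - 1) := rfl

theorem shift_pow_apply (m : ℕ) (f : ZMod d → Y d n u) (j : ZMod d) :
    (shift d n u ^ m) f j = f (j - m) := by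
  induction m generalizing j with
  | zero => simp
  | succ m ih =>
    rw [pow_succ', Module.End.mul_apply, shift_apply, ih, Nat.cast_succ, sub_add_eq_sub_sub_swap]

theorem isNewFraming_shift : IsNewFraming d n (fun i => leftAction d n u (gGen i))
    (fun i => leftAction d n u (tGen i)) (shift d n u) where
  pow := by
    ext f j
    simp [shift_pow_apply]
  comm_g _ _ := rfl
  comm_t _ _ := rfl

/-- The average `e` of the framings of the strand `i` and of the new strand, as an operator on the
functions `ZMod d → Y_{d,n}(u)`. -/
abbrev shiftAverage (d n : ℕ) (u : ℂ) (i : ℕ) : Module.End ℂ (ZMod d → Y d n u) :=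
  newStrandAverage d (fun i => leftAction d n u (tGen i)) (shift d n u) i

/-- The action of `Y_{d,n+1}(u)` on itself by left multiplication, in terms of its decomposition
as a right `Y_{d,n}(u)`-module with basis `g_k ⋯ g_{n-1} t_n^j`. -/
def indRep (d n : ℕ) [NeZero d] (u : ℂ) :
    Y d (n + 1) u →ₐ[ℂ] Module.End ℂ (Fin (n + 1) → ZMod d → Y d n u) :=
  (((yokonumaFamily_gen d n u).map (leftAction d n u)).induced isNewFraming_shift).lift

/-- Right multiplication by elements of `Y_{d,n}(u)` on the module of `indRep`. -/
abbrev indRight (a : Y d n u) : Module.End ℂ (Fin (n + 1) → ZMod d → Y d n u) :=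
  diagonalEnd ℂ (Fin (n + 1)) (ZMod d → Y d n u) fun _ => rightAction a

/-- The vector that corresponds to `1` under the identification in `indRep`. -/
def cyclicVector (d n : ℕ) (u : ℂ) : Fin (n + 1) → ZMod d → Y d n u :=
  Pi.single (Fin.last n) (Pi.single 0 1)

theorem commute_rightAction_leftAction (a b : Y d n u) :
    Commute (rightAction a) (leftAction d n u b) := by
  ext f j
  simp [rightAction_apply, mul_assoc]

theorem commute_rightAction_shift (a : Y d n u) : Commute (rightAction a) (shift d n u) := rfl

variable [NeZero d]

theorem indRep_gGen {i : ℕ} (hi : i < n) : indRep d n u (gGen i)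
    = indG n u (fun i => leftAction d n u (gGen i)) (shiftAverage d n u) i := by
  rw [← g_eq_gGen i (Nat.succ_lt_succ hi), indRep, YokonumaFamily.lift_g]

theorem indRep_tGen {i : ℕ} (hi : i < n + 1) : indRep d n u (tGen i)
    = indT n (fun i => leftAction d n u (tGen i)) (shift d n u) i := by
  rw [← t_eq_tGen i hi, indRep, YokonumaFamily.lift_t]

theorem commute_indRep_indRight (y : Y d (n + 1) u) (a : Y d n u) :
    Commute (indRep d n u y) (indRight a) := by
  induction y using induction_mul with
  | one => exact (map_one (indRep d n u)).symm ▸ Commute.one_left _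
  | add y y' h h' => exact (map_add (indRep d n u) y y').symm ▸ h.add_left h'
  | smul c y h => exact (map_smul (indRep d n u) c y).symm ▸ h.smul_left c
  | g_mul i hi y h =>
    have generator : Commute (indRep d n u (gGen i)) (indRight a) := by
      rw [indRep_gGen (by omega)]
      exact commute_indG_diagonalEnd (fun i _ => commute_rightAction_leftAction a (gGen i))
        (fun i _ => commute_rightAction_leftAction a (tGen i)) (commute_rightAction_shift a)
        (by omega)
    exact (map_mul (indRep d n u) (gGen i) y).symm ▸ generator.mul_left h
  | t_mul i hi y h =>
    have generator : Commute (indRep d n u (tGen i)) (indRight a) := by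
      rw [indRep_tGen hi]
      exact commute_indT_diagonalEnd (fun i _ => commute_rightAction_leftAction a (tGen i))
        (commute_rightAction_shift a) hi
    exact (map_mul (indRep d n u) (tGen i) y).symm ▸ generator.mul_left h

theorem indRep_incl_single_last (a : Y d n u) (f : ZMod d → Y d n u) :
    indRep d n u (incl d n u a) (Pi.single (Fin.last n) f)
      = Pi.single (Fin.last n) (leftAction d n u a f) := by
  induction a using induction_mul with
  | one => simp only [map_one, Module.End.one_apply]
  | add a b ha hb => simp only [map_add, LinearMap.add_apply, ha, hb, Pi.single_add]
  | smul c a ha => simp only [map_smul, LinearMap.smul_apply, ha, Pi.single_smul]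
  | g_mul i hi a ha =>
    rw [map_mul, map_mul, Module.End.mul_apply, ha, incl_gGen hi, indRep_gGen (by omega),
      indG_single_last_of_lt hi, map_mul, Module.End.mul_apply]
  | t_mul i hi a ha =>
    rw [map_mul, map_mul, Module.End.mul_apply, ha, incl_tGen hi, indRep_tGen (by omega),
      indT_single_last_of_lt hi, map_mul, Module.End.mul_apply]

theorem indRep_incl_cyclicVector (a : Y d n u) :
    indRep d n u (incl d n u a) (cyclicVector d n u) = indRight a (cyclicVector d n u) := by
  rw [cyclicVector, indRep_incl_single_last, indRight, diagonalEnd_single]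
  congr 1
  ext j
  rw [rightAction_apply]
  change a * (Pi.single 0 1 : ZMod d → Y d n u) j = _
  obtain rfl | hj := eq_or_ne j 0
  · rw [Pi.single_eq_same, mul_one, one_mul]
  · rw [Pi.single_eq_of_ne hj, mul_zero, zero_mul]

theorem indRep_tGen_pow_cyclicVector (s : ℕ) :
    indRep d n u (tGen n ^ s) (cyclicVector d n u)
      = Pi.single (Fin.last n) (Pi.single (s : ZMod d) 1) := by
  have pow_single (f : ZMod d → Y d n u) : indRep d n u (tGen n ^ s) (Pi.single (Fin.last n) f)
      = Pi.single (Fin.last n) ((shift d n u ^ s) f) := by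
    induction s with
    | zero => simp only [pow_zero, map_one, Module.End.one_apply]
    | succ s ih =>
      rw [pow_succ', map_mul, Module.End.mul_apply, ih, indRep_tGen n.lt_succ_self,
        indT_single_last_self, pow_succ', Module.End.mul_apply]
  rw [cyclicVector, pow_single]
  congr 1
  ext j
  simp only [shift_pow_apply, Pi.single_apply, sub_eq_zero]

theorem indRep_gGen_cyclicVector :
    indRep d (n + 1) u (gGen n) (cyclicVector d (n + 1) u)
      = Pi.single (Fin.castSucc (Fin.last n)) (Pi.single 0 1) := by
  rw [cyclicVector, indRep_gGen n.lt_succ_self, indG_single_last_self]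

end InducedRepresentation

section ConditionalExpectation

variable {d n : ℕ} [NeZero d] {u : ℂ}

/-- The map `f ↦ g_k ⋯ g_{n-2} ∑_j t_{n-1}^j f_j`. It is the partial closure, up to the factor
`z`, of `g_k ⋯ g_{n-1} ∑_j t_n^j f_j`, since `g_{n-1} t_n^j = t_{n-1}^j g_{n-1}`. -/
def closeStrand (d n : ℕ) [NeZero d] (u : ℂ) (k : ℕ) : (ZMod d → Y d n u) →ₗ[ℂ] Y d n u :=
  LinearMap.mulLeft ℂ (ascendingProd gGen k (n - 1 - k))
    ∘ₗ ∑ j : ZMod d, LinearMap.mulLeft ℂ (tGen (n - 1) ^ j.val) ∘ₗ LinearMap.proj j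

theorem closeStrand_apply (k : ℕ) (f : ZMod d → Y d n u) :
    closeStrand d n u k f
      = ascendingProd gGen k (n - 1 - k) * ∑ j, tGen (n - 1) ^ j.val * f j := by
  simp [closeStrand, Finset.mul_sum]

theorem closeStrand_shift {k : ℕ} (hk : k < n) (f : ZMod d → Y d n u) :
    closeStrand d n u k (shift d n u f) = tGen k * closeStrand d n u k f := by
  have t_pow : (tGen (n - 1) : Y d n u) ^ d = 1 := (yokonumaFamily_gen d n u).t_pow _ (by omega)
  have slide := (yokonumaFamily_gen d n u).semiconjBy_ascendingProd_t_last (k := k)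
    (m := n - 1 - k) (by omega)
  rw [show k + (n - 1 - k) = n - 1 by omega] at slide
  rw [closeStrand_apply, closeStrand_apply, ← mul_assoc, ← slide.eq, mul_assoc,
    Finset.mul_sum _ _ (tGen (n - 1)), ← Equiv.sum_comp (Equiv.addRight (1 : ZMod d))]
  congr 1
  refine Finset.sum_congr rfl fun j _ => ?_
  rw [Equiv.coe_addRight, shift_apply, add_sub_cancel_right, pow_val_add t_pow,
    pow_val_one t_pow, pow_mul_comm', mul_assoc]

theorem closeStrand_leftAction {k : ℕ} {a b : Y d n u} (ha : Commute a (tGen (n - 1)))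
    (hab : SemiconjBy (ascendingProd gGen k (n - 1 - k)) a b) (f : ZMod d → Y d n u) :
    closeStrand d n u k (leftAction d n u a f) = b * closeStrand d n u k f := by
  rw [closeStrand_apply, closeStrand_apply, ← mul_assoc, ← hab.eq, mul_assoc,
    Finset.mul_sum _ _ a]
  congr 1
  refine Finset.sum_congr rfl fun j _ => ?_
  rw [← mul_assoc, (ha.pow_right _).eq, mul_assoc]
  rfl

theorem closeStrand_tGen_of_lt {i k : ℕ} (hik : i < k) (hk : k < n) (f : ZMod d → Y d n u) :
    closeStrand d n u k (leftAction d n u (tGen i) f) = tGen i * closeStrand d n u k f :=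
  closeStrand_leftAction ((yokonumaFamily_gen d n u).t_comm _ _ (by omega) (by omega))
    ((yokonumaFamily_gen d n u).commute_ascendingProd_t (by omega) hik).symm f

theorem closeStrand_tGen_of_ge {i k : ℕ} (hik : k ≤ i) (hi : i + 1 < n) (f : ZMod d → Y d n u) :
    closeStrand d n u k (leftAction d n u (tGen i) f) = tGen (i + 1) * closeStrand d n u k f :=
  closeStrand_leftAction ((yokonumaFamily_gen d n u).t_comm _ _ (by omega) (by omega))
    ((yokonumaFamily_gen d n u).semiconjBy_ascendingProd_t (by omega) hik (by omega)) f

theorem closeStrand_gGen_of_lt {i k : ℕ} (hik : i + 1 < k) (hk : k < n) (f : ZMod d → Y d n u) :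
    closeStrand d n u k (leftAction d n u (gGen i) f) = gGen i * closeStrand d n u k f :=
  closeStrand_leftAction
    ((yokonumaFamily_gen d n u).g_t_comm _ _ (by omega) (by omega) (by omega) (by omega))
    ((yokonumaFamily_gen d n u).commute_ascendingProd_g (by omega) hik).symm f

theorem closeStrand_gGen_of_ge {i k : ℕ} (hik : k ≤ i) (hi : i + 2 < n) (f : ZMod d → Y d n u) :
    closeStrand d n u k (leftAction d n u (gGen i) f) = gGen (i + 1) * closeStrand d n u k f :=
  closeStrand_leftAction
    ((yokonumaFamily_gen d n u).g_t_comm _ _ (by omega) (by omega) (by omega) (by omega))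
    ((yokonumaFamily_gen d n u).semiconjBy_ascendingProd_g (by omega) hik (by omega)) f

theorem gGen_mul_closeStrand_succ {i : ℕ} (hi : i + 1 < n) (f : ZMod d → Y d n u) :
    gGen i * closeStrand d n u (i + 1) f = closeStrand d n u i f := by
  rw [closeStrand_apply, closeStrand_apply, show n - 1 - i = (n - 1 - (i + 1)) + 1 by omega,
    ascendingProd, mul_assoc]

theorem map_framingAverage_apply {N A : Type*} [AddCommGroup N] [Module ℂ N] [Ring A] [Algebra ℂ A]
    (f : N →ₗ[ℂ] A) {P Q : Module.End ℂ N} {a b : A} (hP : ∀ v, f (P v) = a * f v)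
    (hQ : ∀ v, f (Q v) = b * f v) (d m : ℕ) (v : N) :
    f (framingAverage d m P Q v) = framingAverage d m a b * f v := by
  have map_pow_apply {R : Module.End ℂ N} {c : A} (h : ∀ v, f (R v) = c * f v) (s : ℕ) (v : N) :
      f ((R ^ s) v) = c ^ s * f v := by
    induction s generalizing v with
    | zero => simp
    | succ s ih => rw [pow_succ', Module.End.mul_apply, h, ih, pow_succ', mul_assoc]
  simp only [framingAverage, LinearMap.smul_apply, LinearMap.sum_apply, Module.End.mul_apply,
    map_smul, map_sum, map_pow_apply hP, map_pow_apply hQ, smul_mul_assoc, Finset.sum_mul,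
    mul_assoc]

theorem closeStrand_shiftAverage_self {i : ℕ} (hi : i + 1 < n) (f : ZMod d → Y d n u) :
    closeStrand d n u i (shiftAverage d n u i f)
      = framingAverage d 0 (tGen i) (tGen (i + 1)) * closeStrand d n u i f := by
  have hi' : i < n := by omega
  have family := yokonumaFamily_gen d n u
  rw [framingAverage_comm (family.t_pow i hi') (family.t_pow _ hi) (family.t_comm _ _ hi' hi)]
  exact map_framingAverage_apply _ (closeStrand_tGen_of_ge le_rfl hi) (closeStrand_shift hi') d 0 f

theorem closeStrand_shiftAverage_succ {i : ℕ} (hi : i + 1 < n) (f : ZMod d → Y d n u) :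
    closeStrand d n u (i + 1) (shiftAverage d n u i f)
      = framingAverage d 0 (tGen i) (tGen (i + 1)) * closeStrand d n u (i + 1) f :=
  map_framingAverage_apply _ (closeStrand_tGen_of_lt i.lt_succ_self hi) (closeStrand_shift hi) d 0 f

theorem closeStrand_indRep_gGen_of_ne {i k : ℕ} (hi : i + 1 < n) (hk : k < n) (hki : k ≠ i)
    (hki' : k ≠ i + 1) (v : Fin (n + 1) → ZMod d → Y d n u) :
    closeStrand d n u k (indRep d n u (gGen i) v ⟨k, Nat.lt_succ_of_lt hk⟩)
      = gGen i * closeStrand d n u k (v ⟨k, Nat.lt_succ_of_lt hk⟩) := by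
  rw [indRep_gGen (by omega)]
  obtain h | h : k < i ∨ i + 1 < k := by omega
  · rw [indG_apply_of_lt _ h, closeStrand_gGen_of_ge (by omega) (by omega),
      Nat.sub_add_cancel (by omega)]
  · rw [indG_apply_of_gt _ h, closeStrand_gGen_of_lt h hk]

theorem closeStrand_indRep_gGen_add {i : ℕ} (hi : i + 1 < n)
    (v : Fin (n + 1) → ZMod d → Y d n u) :
    closeStrand d n u i (indRep d n u (gGen i) v ⟨i, by omega⟩)
        + closeStrand d n u (i + 1) (indRep d n u (gGen i) v ⟨i + 1, by omega⟩)
      = gGen i * (closeStrand d n u i (v ⟨i, by omega⟩)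
        + closeStrand d n u (i + 1) (v ⟨i + 1, by omega⟩)) := by
  have hi' : i < n := by omega
  rw [indRep_gGen hi', indG_apply_self hi', indG_apply_succ]
  simp only [map_add, map_smul]
  rw [closeStrand_shiftAverage_self hi, closeStrand_shiftAverage_succ hi, mul_add,
    gGen_mul_closeStrand_succ hi, ← gGen_mul_closeStrand_succ hi (v ⟨i, _⟩), ← mul_assoc (gGen i),
    (yokonumaFamily_gen d n u).quadratic i hi]
  simp only [add_mul, smul_mul_assoc, one_mul, mul_assoc]
  abel

/-- The linear map out of the module of `indRep` that becomes the conditional expectation. -/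
def closeLast (d n : ℕ) [NeZero d] (u z : ℂ) (x : ZMod d → ℂ) :
    (Fin (n + 1) → ZMod d → Y d n u) →ₗ[ℂ] Y d n u :=
  (∑ j, x j • (LinearMap.proj j ∘ₗ LinearMap.proj (Fin.last n)))
    + z • ∑ k : Fin n, closeStrand d n u k ∘ₗ LinearMap.proj k.castSucc

variable (z : ℂ) (x : ZMod d → ℂ)

theorem closeLast_apply (v : Fin (n + 1) → ZMod d → Y d n u) :
    closeLast d n u z x v = ∑ j, x j • v (Fin.last n) j
      + z • ∑ k : Fin n, closeStrand d n u k (v k.castSucc) := by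
  simp [closeLast]

theorem closeLast_single_last (f : ZMod d → Y d n u) :
    closeLast d n u z x (Pi.single (Fin.last n) f) = ∑ j, x j • f j := by
  have other_summands (k : Fin n) :
      closeStrand d n u k
        ((Pi.single (Fin.last n) f : Fin (n + 1) → ZMod d → Y d n u) k.castSucc) = 0 := by
    rw [Pi.single_eq_of_ne (Fin.castSucc_lt_last k).ne, map_zero]
  simp only [closeLast_apply, Pi.single_eq_same, other_summands, Finset.sum_const_zero, smul_zero,
    add_zero]

theorem closeLast_single_castSucc (k : Fin n) (f : ZMod d → Y d n u) :
    closeLast d n u z x (Pi.single k.castSucc f) = z • closeStrand d n u k f := by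
  rw [closeLast_apply, Pi.single_eq_of_ne (Fin.castSucc_lt_last k).ne',
    Finset.sum_eq_single k fun l _ hl => ?_, Pi.single_eq_same]
  · simp
  · simp
  · rw [Pi.single_eq_of_ne (Fin.castSucc_injective n |>.ne hl), map_zero]

theorem closeLast_indRight (a : Y d n u) (v : Fin (n + 1) → ZMod d → Y d n u) :
    closeLast d n u z x (indRight a v) = closeLast d n u z x v * a := by
  simp only [closeLast_apply, closeStrand_apply, diagonalEnd_apply, rightAction_apply, add_mul,
    smul_mul_assoc, Finset.sum_mul, mul_assoc]

theorem closeLast_gGen {i : ℕ} (hi : i + 1 < n) (v : Fin (n + 1) → ZMod d → Y d n u) :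
    closeLast d n u z x (indRep d n u (gGen i) v) = gGen i * closeLast d n u z x v := by
  have hi' : i < n := by omega
  have last_entry : indRep d n u (gGen i) v (Fin.last n)
      = leftAction d n u (gGen i) (v (Fin.last n)) := by
    rw [indRep_gGen hi']
    exact indG_apply_of_gt n.lt_succ_self hi v
  rw [closeLast_apply, closeLast_apply, last_entry, mul_add, Finset.mul_sum, mul_smul_comm]
  congr 2
  · exact funext fun j => (mul_smul_comm (x j) (gGen i : Y d n u) _).symm
  · rw [← sub_eq_zero, Finset.mul_sum, ← Finset.sum_sub_distrib,
      Fintype.sum_eq_add (⟨i, hi'⟩ : Fin n) ⟨i + 1, hi⟩ (by simp), ← add_sub_add_comm, ← mul_add]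
    · exact sub_eq_zero.2 (closeStrand_indRep_gGen_add hi v)
    · rintro k ⟨hki, hki'⟩
      exact sub_eq_zero.2 (closeStrand_indRep_gGen_of_ne hi k.2 (fun h => hki (Fin.ext h))
        (fun h => hki' (Fin.ext h)) v)

theorem closeLast_tGen {i : ℕ} (hi : i < n) (v : Fin (n + 1) → ZMod d → Y d n u) :
    closeLast d n u z x (indRep d n u (tGen i) v) = tGen i * closeLast d n u z x v := by
  rw [indRep_tGen (by omega), closeLast_apply, closeLast_apply, mul_add, Finset.mul_sum,
    mul_smul_comm, Finset.mul_sum, indT_apply, Fin.val_last, indTEntry_of_gt hi]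
  congr 2
  · exact funext fun j => (mul_smul_comm (x j) (tGen i : Y d n u) _).symm
  · refine Finset.sum_congr rfl fun k _ => ?_
    rw [indT_apply, Fin.val_castSucc]
    obtain h | h | h := lt_trichotomy k.val i
    · rw [indTEntry_of_lt h, closeStrand_tGen_of_ge (by omega) (by omega),
        Nat.sub_add_cancel (by omega)]
    · rw [h, indTEntry_self, closeStrand_shift hi]
    · rw [indTEntry_of_gt h, closeStrand_tGen_of_lt h k.2]

theorem closeLast_incl (a : Y d n u) (v : Fin (n + 1) → ZMod d → Y d n u) :
    closeLast d n u z x (indRep d n u (incl d n u a) v) = a * closeLast d n u z x v := by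
  induction a using induction_mul with
  | one => simp
  | add a b ha hb => rw [map_add, map_add, LinearMap.add_apply, map_add, ha, hb, add_mul]
  | smul c a ha => rw [map_smul, map_smul, LinearMap.smul_apply, map_smul, ha, smul_mul_assoc]
  | g_mul i hi a ha =>
    rw [map_mul, map_mul, Module.End.mul_apply, incl_gGen hi, closeLast_gGen z x hi, ha, mul_assoc]
  | t_mul i hi a ha =>
    rw [map_mul, map_mul, Module.End.mul_apply, incl_tGen hi, closeLast_tGen z x hi, ha, mul_assoc]

/-- The conditional expectation `Y_{d,n+1}(u) → Y_{d,n}(u)` with parameters `z` and `x`. -/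
def expect (d n : ℕ) [NeZero d] (u z : ℂ) (x : ZMod d → ℂ) : Y d (n + 1) u →ₗ[ℂ] Y d n u :=
  closeLast d n u z x ∘ₗ LinearMap.applyₗ (cyclicVector d n u) ∘ₗ (indRep d n u).toLinearMap

theorem expect_apply (y : Y d (n + 1) u) :
    expect d n u z x y = closeLast d n u z x (indRep d n u y (cyclicVector d n u)) := rfl

theorem expect_mul_incl (y : Y d (n + 1) u) (a : Y d n u) :
    expect d n u z x (y * incl d n u a) = expect d n u z x y * a := by
  rw [expect_apply, map_mul, Module.End.mul_apply, indRep_incl_cyclicVector,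
    semiconjBy_apply (commute_indRep_indRight y a), closeLast_indRight, expect_apply]

theorem expect_incl_mul (a : Y d n u) (y : Y d (n + 1) u) :
    expect d n u z x (incl d n u a * y) = a * expect d n u z x y := by
  rw [expect_apply, map_mul, Module.End.mul_apply, closeLast_incl, expect_apply]

theorem expect_tGen_pow (s : ℕ) :
    expect d n u z x (tGen n ^ s) = algebraMap ℂ (Y d n u) (x s) := by
  rw [expect_apply, indRep_tGen_pow_cyclicVector, closeLast_single_last,
    Algebra.algebraMap_eq_smul_one]
  simp [Pi.single_apply]

theorem expect_gGen :
    expect d (n + 1) u z x (gGen n) = algebraMap ℂ (Y d (n + 1) u) z := by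
  rw [expect_apply, indRep_gGen_cyclicVector, closeLast_single_castSucc, closeStrand_apply,
    Algebra.algebraMap_eq_smul_one]
  simp [Pi.single_apply, ascendingProd]

end ConditionalExpectation

section Spanning

variable {d n m : ℕ} {u : ℂ}

theorem commute_incl_tGen (a : Y d n u) : Commute (incl d n u a) (tGen n) := by
  have h := yokonumaFamily_gen d (n + 1) u
  induction a using induction_mul with
  | one => simp
  | add a b ha hb => rw [map_add]; exact ha.add_left hb
  | smul c a ha => rw [map_smul]; exact ha.smul_left c
  | g_mul i hi a ha =>
    rw [map_mul, incl_gGen hi]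
    exact Commute.mul_left (h.g_t_comm i n (by omega) (by omega) (by omega) (by omega)) ha
  | t_mul i hi a ha =>
    rw [map_mul, incl_tGen hi]
    exact Commute.mul_left (h.t_comm i n (by omega) (by omega)) ha

theorem commute_incl_incl_gGen (a : Y d m u) :
    Commute (incl d (m + 1) u (incl d m u a)) (gGen m) := by
  have h := yokonumaFamily_gen d (m + 2) u
  induction a using induction_mul with
  | one => simp
  | add a b ha hb => rw [map_add, map_add]; exact ha.add_left hb
  | smul c a ha => rw [map_smul, map_smul]; exact ha.smul_left c
  | g_mul i hi a ha =>
    rw [map_mul, map_mul, incl_gGen hi, incl_gGen (by omega)]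
    exact Commute.mul_left (h.g_comm i m (by omega) (by omega)) ha
  | t_mul i hi a ha =>
    rw [map_mul, map_mul, incl_tGen hi, incl_tGen (by omega)]
    exact Commute.mul_left
      (h.g_t_comm m i (by omega) (by omega) (by omega) (by omega)).symm ha

theorem gGen_mul_tGen_pow (s : ℕ) :
    (gGen m * tGen m ^ s : Y d (m + 2) u) = tGen (m + 1) ^ s * gGen m :=
  (((yokonumaFamily_gen d (m + 2) u).g_t_left m (by omega)).pow_right s).eq

theorem gGen_mul_tGen_succ_pow (s : ℕ) :
    (gGen m * tGen (m + 1) ^ s : Y d (m + 2) u) = tGen m ^ s * gGen m :=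
  (((yokonumaFamily_gen d (m + 2) u).g_t_right m (by omega)).pow_right s).eq

/-- The span of the elements `a g_{n-1} b` and `a t_n^s` of `Y_{d,n+1}(u)`, where `a` and `b` are in
the image of `Y_{d,n}(u)`. It turns out to be everything. -/
def lastSpan (d n : ℕ) (u : ℂ) : Submodule ℂ (Y d (n + 1) u) :=
  Submodule.span ℂ {y | (∃ m, n = m + 1 ∧ ∃ a b, y = incl d n u a * gGen m * incl d n u b)
    ∨ ∃ a s, y = incl d n u a * tGen n ^ s}

theorem incl_mul_gGen_mul_incl_mem_lastSpan (a b : Y d (m + 1) u) :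
    incl d (m + 1) u a * gGen m * incl d (m + 1) u b ∈ lastSpan d (m + 1) u :=
  Submodule.subset_span (Or.inl ⟨m, rfl, a, b, rfl⟩)

theorem incl_mul_tGen_pow_mem_lastSpan (a : Y d n u) (s : ℕ) :
    incl d n u a * tGen n ^ s ∈ lastSpan d n u :=
  Submodule.subset_span (Or.inr ⟨a, s, rfl⟩)

theorem lastSpan_le {S : Submodule ℂ (Y d (n + 1) u)}
    (g_last : ∀ m, n = m + 1 → ∀ a b, incl d n u a * gGen m * incl d n u b ∈ S)
    (t_last : ∀ a s, incl d n u a * tGen n ^ s ∈ S) : lastSpan d n u ≤ S := by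
  refine Submodule.span_le.2 ?_
  rintro _ (⟨m, hm, a, b, rfl⟩ | ⟨a, s, rfl⟩)
  · exact g_last m hm a b
  · exact t_last a s

theorem one_mem_lastSpan : (1 : Y d (n + 1) u) ∈ lastSpan d n u := by
  simpa using incl_mul_tGen_pow_mem_lastSpan (1 : Y d n u) 0

theorem gGen_mem_lastSpan : (gGen m : Y d (m + 2) u) ∈ lastSpan d (m + 1) u := by
  simpa using incl_mul_gGen_mul_incl_mem_lastSpan (1 : Y d (m + 1) u) 1

theorem incl_mul_mem_lastSpan (a : Y d n u) {y : Y d (n + 1) u} (hy : y ∈ lastSpan d n u) :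
    incl d n u a * y ∈ lastSpan d n u := by
  refine lastSpan_le (S := (lastSpan d n u).comap (LinearMap.mulLeft ℂ (incl d n u a))) ?_ ?_ hy
  · rintro m rfl b c
    simpa only [Submodule.mem_comap, LinearMap.mulLeft_apply, map_mul, mul_assoc] using
      incl_mul_gGen_mul_incl_mem_lastSpan (a * b) c
  · intro b s
    simpa only [Submodule.mem_comap, LinearMap.mulLeft_apply, map_mul, mul_assoc] using
      incl_mul_tGen_pow_mem_lastSpan (a * b) s

theorem mul_incl_mem_lastSpan (a : Y d n u) {y : Y d (n + 1) u} (hy : y ∈ lastSpan d n u) :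
    y * incl d n u a ∈ lastSpan d n u := by
  refine lastSpan_le (S := (lastSpan d n u).comap (LinearMap.mulRight ℂ (incl d n u a))) ?_ ?_ hy
  · rintro m rfl b c
    simpa only [Submodule.mem_comap, LinearMap.mulRight_apply, map_mul, mul_assoc] using
      incl_mul_gGen_mul_incl_mem_lastSpan b (c * a)
  · intro b s
    simpa only [Submodule.mem_comap, LinearMap.mulRight_apply, map_mul, mul_assoc,
      ((commute_incl_tGen a).pow_right s).eq] using incl_mul_tGen_pow_mem_lastSpan (b * a) s

theorem tGen_pow_mul_mem_lastSpan (s : ℕ) {y : Y d (n + 1) u} (hy : y ∈ lastSpan d n u) :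
    tGen n ^ s * y ∈ lastSpan d n u := by
  refine lastSpan_le (S := (lastSpan d n u).comap (LinearMap.mulLeft ℂ (tGen n ^ s))) ?_ ?_ hy
  · rintro m rfl b c
    have slide : tGen (m + 1) ^ s * (incl d (m + 1) u b * gGen m * incl d (m + 1) u c)
        = incl d (m + 1) u b * gGen m * incl d (m + 1) u (tGen m ^ s * c) := by
      rw [map_mul, map_pow, incl_tGen m.lt_succ_self, ← mul_assoc, ← mul_assoc,
        ← ((commute_incl_tGen b).pow_right s).eq, mul_assoc _ _ (gGen m), ← gGen_mul_tGen_pow]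
      simp only [mul_assoc]
    rw [Submodule.mem_comap, LinearMap.mulLeft_apply, slide]
    exact incl_mul_gGen_mul_incl_mem_lastSpan _ _
  · intro b r
    rw [Submodule.mem_comap, LinearMap.mulLeft_apply, ← mul_assoc,
      ← ((commute_incl_tGen b).pow_right s).eq, mul_assoc, ← pow_add]
    exact incl_mul_tGen_pow_mem_lastSpan b _

theorem gGen_mul_gGen_mem_lastSpan :
    (gGen m * gGen m : Y d (m + 2) u) ∈ lastSpan d (m + 1) u := by
  have e_mul_mem {y : Y d (m + 2) u} (hy : y ∈ lastSpan d (m + 1) u) :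
      framingAverage d 0 (tGen m) (tGen (m + 1)) * y ∈ lastSpan d (m + 1) u := by
    rw [framingAverage, smul_mul_assoc, Finset.sum_mul, ← incl_tGen m.lt_succ_self]
    refine Submodule.smul_mem _ _ (Submodule.sum_mem _ fun s _ => ?_)
    rw [mul_assoc, ← map_pow]
    exact incl_mul_mem_lastSpan _ (tGen_pow_mul_mem_lastSpan _ hy)
  rw [(yokonumaFamily_gen d (m + 2) u).quadratic m (by omega)]
  refine add_mem (add_mem one_mem_lastSpan (Submodule.smul_mem _ _ ?_))
    (Submodule.smul_mem _ _ (e_mul_mem gGen_mem_lastSpan))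
  simpa only [mul_one] using e_mul_mem one_mem_lastSpan

theorem gGen_mul_incl_mul_gGen_mem_lastSpan {a : Y d (m + 1) u} (ha : a ∈ lastSpan d m u) :
    gGen m * incl d (m + 1) u a * gGen m ∈ lastSpan d (m + 1) u := by
  refine lastSpan_le (S := (lastSpan d (m + 1) u).comap (LinearMap.mulRight ℂ (gGen m)
    ∘ₗ LinearMap.mulLeft ℂ (gGen m) ∘ₗ (incl d (m + 1) u).toLinearMap)) ?_ ?_ ha
  all_goals simp only [Submodule.mem_comap, LinearMap.comp_apply, AlgHom.toLinearMap_apply,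
    LinearMap.mulLeft_apply, LinearMap.mulRight_apply, map_mul, map_pow]
  · rintro l rfl b c
    have braid_inner : gGen (l + 1) * (incl d (l + 2) u (incl d (l + 1) u b)
          * incl d (l + 2) u (gGen l) * incl d (l + 2) u (incl d (l + 1) u c)) * gGen (l + 1)
        = incl d (l + 2) u (incl d (l + 1) u b) * (incl d (l + 2) u (gGen l) * gGen (l + 1)
          * incl d (l + 2) u (gGen l)) * incl d (l + 2) u (incl d (l + 1) u c) := by
      rw [incl_gGen (by omega), ← (yokonumaFamily_gen d (l + 3) u).braid l (by omega), ← mul_assoc,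
        ← mul_assoc, ← (commute_incl_incl_gGen b).eq, mul_assoc _ _ (gGen (l + 1)),
        (commute_incl_incl_gGen c).eq]
      simp only [mul_assoc]
    rw [braid_inner]
    exact mul_incl_mem_lastSpan _ (incl_mul_mem_lastSpan _
      (incl_mul_gGen_mul_incl_mem_lastSpan _ _))
  · intro b s
    rw [← mul_assoc, ← (commute_incl_incl_gGen b).eq, incl_tGen m.lt_succ_self,
      mul_assoc _ (gGen m), gGen_mul_tGen_pow, mul_assoc, mul_assoc]
    exact incl_mul_mem_lastSpan _ (tGen_pow_mul_mem_lastSpan s gGen_mul_gGen_mem_lastSpan)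

theorem gGen_mul_mem_lastSpan (hm : lastSpan d m u = ⊤) {y : Y d (m + 2) u}
    (hy : y ∈ lastSpan d (m + 1) u) : gGen m * y ∈ lastSpan d (m + 1) u := by
  refine lastSpan_le (S := (lastSpan d (m + 1) u).comap (LinearMap.mulLeft ℂ (gGen m))) ?_ ?_ hy
  all_goals simp only [Submodule.mem_comap, LinearMap.mulLeft_apply]
  · intro l hl b c
    obtain rfl : m = l := by omega
    rw [← mul_assoc, ← mul_assoc]
    exact mul_incl_mem_lastSpan _ (gGen_mul_incl_mul_gGen_mem_lastSpan (hm ▸ Submodule.mem_top))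
  · intro b s
    rw [((commute_incl_tGen b).pow_right s).eq, ← mul_assoc, gGen_mul_tGen_succ_pow,
      ← incl_tGen m.lt_succ_self, ← map_pow]
    exact incl_mul_gGen_mul_incl_mem_lastSpan _ _

theorem lastSpan_eq_top (d n : ℕ) (u : ℂ) : lastSpan d n u = ⊤ := by
  induction n with
  | zero =>
    refine Submodule.eq_top_iff'.2 fun y => ?_
    induction y using induction_mul with
    | one => exact one_mem_lastSpan
    | add a b ha hb => exact add_mem ha hb
    | smul c a ha => exact Submodule.smul_mem _ _ ha
    | g_mul i hi a _ => omega
    | t_mul i hi a ha =>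
      obtain rfl : i = 0 := by omega
      simpa only [pow_one] using tGen_pow_mul_mem_lastSpan 1 ha
  | succ m ih =>
    refine Submodule.eq_top_iff'.2 fun y => ?_
    induction y using induction_mul with
    | one => exact one_mem_lastSpan
    | add a b ha hb => exact add_mem ha hb
    | smul c a ha => exact Submodule.smul_mem _ _ ha
    | g_mul i hi a ha =>
      obtain rfl | him := eq_or_ne i m
      · exact gGen_mul_mem_lastSpan ih ha
      · rw [← incl_gGen (by omega)]
        exact incl_mul_mem_lastSpan _ ha
    | t_mul i hi a ha =>
      obtain rfl | him := eq_or_ne i (m + 1)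
      · simpa only [pow_one] using tGen_pow_mul_mem_lastSpan 1 ha
      · rw [← incl_tGen (by omega)]
        exact incl_mul_mem_lastSpan _ ha

theorem linearMap_ext_last {M : Type*} [AddCommGroup M] [Module ℂ M] {φ ψ : Y d (n + 1) u →ₗ[ℂ] M}
    (g_last : ∀ m, n = m + 1 → ∀ a b, φ (incl d n u a * gGen m * incl d n u b)
      = ψ (incl d n u a * gGen m * incl d n u b))
    (t_last : ∀ a s, φ (incl d n u a * tGen n ^ s) = ψ (incl d n u a * tGen n ^ s)) : φ = ψ :=
  LinearMap.ext fun _ => lastSpan_le (S := LinearMap.eqLocus φ ψ) g_last t_last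
    (lastSpan_eq_top d n u ▸ Submodule.mem_top)

@[elab_as_elim]
theorem induction_bimodule {P : Y d (n + 1) u → Prop} (add : ∀ a b, P a → P b → P (a + b))
    (incl_mul : ∀ c a, P a → P (incl d n u c * a)) (mul_incl : ∀ c a, P a → P (a * incl d n u c))
    (g_last : ∀ m, n = m + 1 → P (gGen m)) (t_last : ∀ s, P (tGen n ^ s)) (y : Y d (n + 1) u) :
    P y := by
  have smul (c : ℂ) (a) (ha : P a) : P (c • a) := by
    simpa only [AlgHom.commutes, Algebra.smul_def] using incl_mul (algebraMap ℂ _ c) a ha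
  let S : Submodule ℂ (Y d (n + 1) u) :=
    { carrier := {y | P y}
      add_mem' := add _ _
      zero_mem' := zero_smul ℂ (1 : Y d (n + 1) u) ▸ smul 0 1 (pow_zero (tGen n) ▸ t_last 0)
      smul_mem' := smul }
  refine lastSpan_le (S := S) (fun m hm a b => ?_) (fun a s => ?_)
    (lastSpan_eq_top d n u ▸ Submodule.mem_top)
  · exact mul_incl b _ (incl_mul a _ (g_last m hm))
  · exact incl_mul a _ (t_last s)

end Spanning

section EncirclingStrand

variable {d n m : ℕ} [NeZero d] {u z : ℂ} {x : ZMod d → ℂ}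

theorem tGen_pow_eq_one {d : ℕ} (hm : m < n) : (tGen m : Y d n u) ^ d = 1 :=
  (yokonumaFamily_gen d n u).t_pow m hm

theorem commute_tGen {d : ℕ} (hm : m + 1 < n) : Commute (tGen m : Y d n u) (tGen (m + 1)) :=
  (yokonumaFamily_gen d n u).t_comm m (m + 1) (by omega) hm

theorem expect_incl_mul_gGen_mul_incl (a b : Y d (m + 1) u) :
    expect d (m + 1) u z x (incl d (m + 1) u a * gGen m * incl d (m + 1) u b) = z • (a * b) := by
  rw [expect_mul_incl, expect_incl_mul, expect_gGen, ← Algebra.commutes, ← Algebra.smul_def,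
    smul_mul_assoc]

theorem expect_incl_mul_tGen_pow (a : Y d n u) (s : ℕ) :
    expect d n u z x (incl d n u a * tGen n ^ s) = x s • a := by
  rw [expect_incl_mul, expect_tGen_pow, ← Algebra.commutes, ← Algebra.smul_def]

theorem expect_tGen_pow_val (j : ZMod d) :
    expect d n u z x (tGen n ^ j.val) = x j • 1 := by
  rw [expect_tGen_pow, ZMod.natCast_zmod_val, Algebra.algebraMap_eq_smul_one]

theorem expect_tGen_pow_mul_gGen (s : ℕ) :
    expect d (m + 1) u z x (tGen m ^ s * gGen m) = z • tGen m ^ s := by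
  simpa only [map_pow, incl_tGen m.lt_succ_self, map_one, mul_one] using
    expect_incl_mul_gGen_mul_incl (z := z) (x := x) (tGen m ^ s : Y d (m + 1) u) 1

theorem expect_tGen_succ_pow_mul_gGen (s : ℕ) :
    expect d (m + 1) u z x (tGen (m + 1) ^ s * gGen m) = z • tGen m ^ s := by
  simpa only [map_pow, incl_tGen m.lt_succ_self, map_one, one_mul, gGen_mul_tGen_pow] using
    expect_incl_mul_gGen_mul_incl (z := z) (x := x) 1 (tGen m ^ s : Y d (m + 1) u)

theorem tGen_pow_mul_framingAverage (s : ZMod d) :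
    (tGen (m + 1) ^ s.val * framingAverage d 0 (tGen m) (tGen (m + 1)) : Y d (m + 2) u)
      = (1 / d : ℂ) • ∑ r : ZMod d, tGen m ^ r.val * tGen (m + 1) ^ (s - r).val := by
  rw [framingAverage_zero_eq_sum_zmod (tGen_pow_eq_one (by omega)) (tGen_pow_eq_one (by omega)),
    mul_smul_comm, Finset.mul_sum]
  congr 1
  refine Finset.sum_congr rfl fun r _ => ?_
  rw [← mul_assoc, ((commute_tGen (by omega)).symm.pow_pow _ _).eq, mul_assoc,
    ← pow_val_add (tGen_pow_eq_one (by omega)), sub_eq_add_neg]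

/-- The conditional expectation of `g_n t_n^s g_n`. -/
def encircledFraming (d n : ℕ) [NeZero d] (u z : ℂ) (x : ZMod d → ℂ) (s : ZMod d) :
    Y d (n + 1) u :=
  x s • 1 + (u - 1) • ((1 / d : ℂ) • ∑ r : ZMod d, x (s - r) • tGen n ^ r.val)
    + (u - 1) • z • tGen n ^ s.val

theorem expect_tGen_pow_mul_framingAverage (s : ZMod d) :
    expect d (m + 1) u z x
        (tGen (m + 1) ^ s.val * framingAverage d 0 (tGen m) (tGen (m + 1)))
      = (1 / d : ℂ) • ∑ r : ZMod d, x (s - r) • tGen m ^ r.val := by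
  have summand (r : ZMod d) :
      expect d (m + 1) u z x (tGen m ^ r.val * tGen (m + 1) ^ (s - r).val)
        = x (s - r) • tGen m ^ r.val := by
    rw [← incl_tGen m.lt_succ_self, ← map_pow, expect_incl_mul_tGen_pow, ZMod.natCast_zmod_val]
  simp only [tGen_pow_mul_framingAverage, map_smul, map_sum, summand]

theorem expect_tGen_pow_mul_framingAverage_mul_gGen (s : ZMod d) :
    expect d (m + 1) u z x
        (tGen (m + 1) ^ s.val * framingAverage d 0 (tGen m) (tGen (m + 1)) * gGen m)
      = z • tGen m ^ s.val := by
  have summand (r : ZMod d) :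
      expect d (m + 1) u z x (tGen m ^ r.val * tGen (m + 1) ^ (s - r).val * gGen m)
        = z • tGen m ^ s.val := by
    rw [mul_assoc, ← incl_tGen m.lt_succ_self, ← map_pow, expect_incl_mul,
      expect_tGen_succ_pow_mul_gGen, mul_smul_comm, ← pow_val_add (tGen_pow_eq_one (by omega)),
      add_sub_cancel]
  simp only [tGen_pow_mul_framingAverage, smul_mul_assoc, map_smul, Finset.sum_mul, map_sum,
    summand, Finset.sum_const, Finset.card_univ, ZMod.card]
  rw [← Nat.cast_smul_eq_nsmul ℂ, smul_smul, one_div_mul_cancel (Nat.cast_ne_zero.2 (NeZero.ne d)),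
    one_smul]

theorem expect_tGen_pow_mul_gGen_mul_gGen (s : ZMod d) :
    expect d (m + 1) u z x (tGen (m + 1) ^ s.val * (gGen m * gGen m))
      = encircledFraming d m u z x s := by
  rw [(yokonumaFamily_gen d (m + 2) u).quadratic m (by omega), mul_add, mul_add, mul_one,
    mul_smul_comm, mul_smul_comm, ← mul_assoc, map_add, map_add, map_smul, map_smul,
    expect_tGen_pow_val, expect_tGen_pow_mul_framingAverage,
    expect_tGen_pow_mul_framingAverage_mul_gGen, encircledFraming]

theorem commute_incl_encircledFraming (a : Y d n u) (s : ZMod d) :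
    Commute (incl d n u a) (encircledFraming d n u z x s) := by
  have pow (r : ℕ) := (commute_incl_tGen a).pow_right r
  have sum : Commute (incl d n u a) (∑ r : ZMod d, x (s - r) • tGen n ^ r.val) :=
    Commute.sum_right _ _ _ fun r _ => (pow r.val).smul_right _
  exact (((Commute.one_right _).smul_right _).add_right
    ((sum.smul_right _).smul_right _)).add_right (((pow s.val).smul_right _).smul_right _)

theorem expect_encircledFraming_mul_tGen_pow (s r : ZMod d) :
    expect d n u z x (encircledFraming d n u z x s * tGen n ^ r.val)
      = (x s * x r + (u - 1) * (1 / d * ∑ q : ZMod d, x (s - q) * x (q + r))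
          + (u - 1) * (z * x (s + r))) • 1 := by
  simp only [encircledFraming, add_mul, smul_mul_assoc, one_mul, Finset.sum_mul,
    ← pow_val_add (tGen_pow_eq_one n.lt_succ_self), map_add, map_smul, map_sum,
    expect_tGen_pow_val, add_smul, mul_smul, Finset.sum_smul]

theorem expect_encircledFraming_mul_tGen_pow_comm (s r : ZMod d) :
    expect d n u z x (encircledFraming d n u z x s * tGen n ^ r.val)
      = expect d n u z x (encircledFraming d n u z x r * tGen n ^ s.val) := by
  have convolution_comm : ∑ q : ZMod d, x (s - q) * x (q + r) = ∑ q, x (r - q) * x (q + s) := by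
    rw [← Equiv.sum_comp (Equiv.neg (ZMod d))]
    refine Finset.sum_congr rfl fun q _ => ?_
    rw [Equiv.neg_apply, mul_comm, sub_neg_eq_add, neg_add_eq_sub, add_comm s]
  rw [expect_encircledFraming_mul_tGen_pow, expect_encircledFraming_mul_tGen_pow,
    convolution_comm, mul_comm (x s), add_comm s]

theorem expect_encircledFraming_mul_gGen (s : ZMod d) :
    expect d (m + 1) u z x (encircledFraming d (m + 1) u z x s * gGen m)
      = z • encircledFraming d m u z x s := by
  simp only [encircledFraming, add_mul, smul_mul_assoc, one_mul, Finset.sum_mul, map_add,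
    map_smul, map_sum, expect_tGen_succ_pow_mul_gGen, expect_gGen, Algebra.algebraMap_eq_smul_one,
    smul_add, Finset.smul_sum, smul_smul]
  simp only [mul_comm]

variable (d n u z x) in
/-- The linear map `a ↦ ε(g_n a g_n)` on `Y_{d,n+1}(u)`, where `ε` is the conditional
expectation. -/
def encircle : Y d (n + 1) u →ₗ[ℂ] Y d (n + 1) u :=
  expect d (n + 1) u z x ∘ₗ LinearMap.mulRight ℂ (gGen n) ∘ₗ LinearMap.mulLeft ℂ (gGen n)
    ∘ₗ (incl d (n + 1) u).toLinearMap

theorem encircle_apply (a : Y d (n + 1) u) :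
    encircle d n u z x a = expect d (n + 1) u z x (gGen n * incl d (n + 1) u a * gGen n) := rfl

theorem encircle_incl_mul (c : Y d n u) (a : Y d (n + 1) u) :
    encircle d n u z x (incl d n u c * a) = incl d n u c * encircle d n u z x a := by
  rw [encircle_apply, map_mul (incl d (n + 1) u), ← mul_assoc, ← (commute_incl_incl_gGen c).eq,
    mul_assoc, mul_assoc, expect_incl_mul, encircle_apply, mul_assoc]

theorem encircle_mul_incl (c : Y d n u) (a : Y d (n + 1) u) :
    encircle d n u z x (a * incl d n u c) = encircle d n u z x a * incl d n u c := by
  rw [encircle_apply, map_mul (incl d (n + 1) u), mul_assoc, mul_assoc,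
    (commute_incl_incl_gGen c).eq, ← mul_assoc, ← mul_assoc, expect_mul_incl, encircle_apply]

theorem encircle_tGen_pow (s : ℕ) :
    encircle d n u z x (tGen n ^ s) = encircledFraming d n u z x s := by
  rw [encircle_apply, map_pow, incl_tGen n.lt_succ_self, gGen_mul_tGen_pow, mul_assoc,
    ← expect_tGen_pow_mul_gGen_mul_gGen, pow_val_natCast (tGen_pow_eq_one (by omega))]

theorem encircle_gGen : encircle d (m + 1) u z x (gGen m) = z • (gGen m * gGen m) := by
  have incl_g : incl d (m + 2) u (gGen m) = gGen m := incl_gGen (by omega)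
  rw [encircle_apply, incl_g, (yokonumaFamily_gen d (m + 3) u).braid m (by omega), ← incl_g,
    expect_incl_mul_gGen_mul_incl]

end EncirclingStrand

section SymmetryOfTheExpectation

variable {d n m : ℕ} [NeZero d] {u z : ℂ} {x : ZMod d → ℂ}

theorem expect_tGen_mul_comm (y : Y d (n + 1) u) :
    expect d n u z x (tGen n * y) = expect d n u z x (y * tGen n) := by
  induction y using induction_bimodule with
  | add a b ha hb => simp only [mul_add, add_mul, map_add, ha, hb]
  | incl_mul c a ha =>
    rw [← mul_assoc, ← (commute_incl_tGen c).eq, mul_assoc, mul_assoc, expect_incl_mul, ha,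
      expect_incl_mul]
  | mul_incl c a ha =>
    rw [mul_assoc, (commute_incl_tGen c).eq, ← mul_assoc, ← mul_assoc, expect_mul_incl, ha,
      expect_mul_incl]
  | g_last m hm =>
    subst hm
    have left := expect_tGen_succ_pow_mul_gGen (m := m) (u := u) (z := z) (x := x) 1
    have right := expect_tGen_pow_mul_gGen (m := m) (u := u) (z := z) (x := x) 1
    have slide := gGen_mul_tGen_succ_pow (d := d) (m := m) (u := u) 1
    simp only [pow_one] at left right slide
    rw [left, slide, right]
  | t_last s => rw [pow_mul_comm']

theorem gGen_mul_gGen_mul_gGen {d : ℕ} :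
    (gGen m * gGen m * gGen m : Y d (m + 2) u)
      = gGen m + (u - 1) • (framingAverage d 0 (tGen m) (tGen (m + 1)) * gGen m)
        + (u - 1) • (framingAverage d 0 (tGen m) (tGen (m + 1)) * (gGen m * gGen m)) := by
  conv_lhs => rw [(yokonumaFamily_gen d (m + 2) u).quadratic m (by omega)]
  simp only [add_mul, one_mul, smul_mul_assoc, mul_assoc]

theorem tGen_pow_mul_framingAverage_comm (s : ℕ) :
    (tGen m ^ s * framingAverage d 0 (tGen m) (tGen (m + 1)) : Y d (m + 2) u)
      = tGen (m + 1) ^ s * framingAverage d 0 (tGen m) (tGen (m + 1)) := by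
  have comm : Commute (tGen m : Y d (m + 2) u) (tGen (m + 1)) := commute_tGen (by omega)
  have left := (commute_framingAverage (d := d) 0 (Commute.refl (tGen m)) comm).pow_left s
  have right := (commute_framingAverage (d := d) 0 comm.symm (Commute.refl _)).pow_left s
  rw [left.eq, right.eq,
    framingAverage_mul_pow (tGen_pow_eq_one (by omega)) (tGen_pow_eq_one (by omega)) comm]

theorem expect_gGen_sq_mul_tGen_pow_mul_gGen (s : ℕ) :
    expect d (m + 1) u z x (gGen m * gGen m * tGen m ^ s * gGen m)
      = expect d (m + 1) u z x (gGen m * tGen m ^ s * gGen m * gGen m) := by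
  have left : (gGen m * gGen m * tGen m ^ s * gGen m : Y d (m + 2) u)
      = tGen m ^ s * (gGen m * gGen m * gGen m) := by
    rw [mul_assoc (gGen m), gGen_mul_tGen_pow, ← mul_assoc (gGen m), gGen_mul_tGen_succ_pow]
    simp only [mul_assoc]
  have right : (gGen m * tGen m ^ s * gGen m * gGen m : Y d (m + 2) u)
      = tGen (m + 1) ^ s * (gGen m * gGen m * gGen m) := by
    rw [gGen_mul_tGen_pow]
    simp only [mul_assoc]
  rw [left, right, gGen_mul_gGen_mul_gGen]
  simp only [mul_add, mul_smul_comm, ← mul_assoc, tGen_pow_mul_framingAverage_comm, map_add,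
    expect_tGen_pow_mul_gGen, expect_tGen_succ_pow_mul_gGen]

theorem expect_gGen_sq_mul_gGen_mul_gGen :
    expect d (m + 2) u z x (gGen (m + 1) * gGen (m + 1) * gGen m * gGen (m + 1))
      = expect d (m + 2) u z x (gGen (m + 1) * gGen m * gGen (m + 1) * gGen (m + 1)) := by
  have incl_g : incl d (m + 2) u (gGen m) = gGen m := incl_gGen (by omega)
  have braid := (yokonumaFamily_gen d (m + 3) u).braid m (by omega)
  have left : gGen (m + 1) * gGen (m + 1) * gGen m * gGen (m + 1)
      = incl d (m + 2) u (gGen m) * gGen (m + 1) * incl d (m + 2) u (gGen m * gGen m) := by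
    rw [map_mul, incl_g, mul_assoc, mul_assoc, ← mul_assoc (gGen (m + 1)) (gGen m), braid,
      ← mul_assoc, ← mul_assoc, braid, mul_assoc]
  have right : gGen (m + 1) * gGen m * gGen (m + 1) * gGen (m + 1)
      = incl d (m + 2) u (gGen m * gGen m) * gGen (m + 1) * incl d (m + 2) u (gGen m) := by
    rw [map_mul, incl_g, braid, mul_assoc, mul_assoc, ← mul_assoc (gGen (m + 1)), braid]
    simp only [mul_assoc]
  rw [left, right, expect_incl_mul_gGen_mul_incl, expect_incl_mul_gGen_mul_incl, mul_assoc]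

theorem expect_gGen_sq_mul_incl_mul_gGen (c : Y d (m + 1) u) :
    expect d (m + 1) u z x (gGen m * gGen m * incl d (m + 1) u c * gGen m)
      = expect d (m + 1) u z x (gGen m * incl d (m + 1) u c * gGen m * gGen m) := by
  induction c using induction_bimodule with
  | add a b ha hb => simp only [map_add, mul_add, add_mul, ha, hb]
  | incl_mul c a ha =>
    have comm := commute_incl_incl_gGen c
    rw [map_mul (incl d (m + 1) u), ← mul_assoc, ← mul_assoc, ← (comm.mul_right comm).eq, ← comm.eq]
    simp only [mul_assoc, expect_incl_mul] at ha ⊢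
    rw [ha]
  | mul_incl c a ha =>
    have comm := commute_incl_incl_gGen c
    rw [map_mul (incl d (m + 1) u), ← mul_assoc, ← mul_assoc, mul_assoc _ _ (gGen m), comm.eq,
      mul_assoc _ (gGen m) (gGen m), mul_assoc _ _ (gGen m * gGen m), (comm.mul_right comm).eq,
      ← mul_assoc, ← mul_assoc, expect_mul_incl, expect_mul_incl, ha, mul_assoc _ (gGen m)]
  | g_last l hl =>
    subst hl
    rw [incl_gGen (by omega), expect_gGen_sq_mul_gGen_mul_gGen]
  | t_last s =>
    rw [map_pow, incl_tGen m.lt_succ_self, expect_gGen_sq_mul_tGen_pow_mul_gGen]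

theorem expect_encircledFraming_mul (s : ℕ) (b : Y d (n + 1) u) :
    expect d n u z x (encircledFraming d n u z x s * b)
      = expect d n u z x (encircle d n u z x b * tGen n ^ s) := by
  induction b using induction_bimodule with
  | add a b ha hb => simp only [map_add, mul_add, add_mul, ha, hb]
  | incl_mul c a ha =>
    rw [← mul_assoc, ← (commute_incl_encircledFraming c _).eq, mul_assoc, expect_incl_mul, ha,
      encircle_incl_mul, mul_assoc, expect_incl_mul]
  | mul_incl c a ha =>
    rw [← mul_assoc, expect_mul_incl, ha, encircle_mul_incl, mul_assoc,
      ((commute_incl_tGen c).pow_right s).eq, ← mul_assoc, expect_mul_incl]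
  | g_last m hm =>
    subst hm
    have slide : (gGen m * gGen m * tGen (m + 1) ^ s : Y d (m + 2) u)
        = tGen (m + 1) ^ s * (gGen m * gGen m) := by
      rw [mul_assoc, gGen_mul_tGen_succ_pow, ← mul_assoc, gGen_mul_tGen_pow, mul_assoc]
    rw [expect_encircledFraming_mul_gGen, encircle_gGen, smul_mul_assoc, map_smul, slide,
      ← pow_val_natCast (tGen_pow_eq_one (by omega)) s, expect_tGen_pow_mul_gGen_mul_gGen]
  | t_last r =>
    rw [encircle_tGen_pow, ← pow_val_natCast (tGen_pow_eq_one n.lt_succ_self) r,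
      ← pow_val_natCast (tGen_pow_eq_one n.lt_succ_self) s,
      expect_encircledFraming_mul_tGen_pow_comm]

end SymmetryOfTheExpectation

section MarkovTrace

variable {d n m : ℕ} [NeZero d] {u z : ℂ} {x : ZMod d → ℂ}

theorem yokonumaFamily_zero (d : ℕ) (u : ℂ) {A : Type*} [Ring A] [Algebra ℂ A] (G T : ℕ → A) :
    YokonumaFamily d 0 u G T := by
  constructor <;> intros <;> omega

/-- The composite of the conditional expectations, preceded by the isomorphism
`Y_{d,0}(u) = ℂ`. It is the Markov trace with parameters `z` and `x`. -/
def markovTrace (d : ℕ) [NeZero d] (u z : ℂ) (x : ZMod d → ℂ) : ∀ n : ℕ, Y d n u →ₗ[ℂ] ℂ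
  | 0 => (yokonumaFamily_zero d u (0 : ℕ → ℂ) 0).lift.toLinearMap
  | n + 1 => markovTrace d u z x n ∘ₗ expect d n u z x

theorem markovTrace_succ (y : Y d (n + 1) u) :
    markovTrace d u z x (n + 1) y = markovTrace d u z x n (expect d n u z x y) := rfl

theorem markovTrace_incl_mul_comm
    (tr_comm : ∀ a b, markovTrace d u z x n (a * b) = markovTrace d u z x n (b * a))
    (c : Y d n u) (y : Y d (n + 1) u) :
    markovTrace d u z x (n + 1) (incl d n u c * y)
      = markovTrace d u z x (n + 1) (y * incl d n u c) := by
  rw [markovTrace_succ, markovTrace_succ, expect_incl_mul, expect_mul_incl, tr_comm]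

theorem markovTrace_tGen_mul_comm (y : Y d (n + 1) u) :
    markovTrace d u z x (n + 1) (tGen n * y) = markovTrace d u z x (n + 1) (y * tGen n) := by
  rw [markovTrace_succ, expect_tGen_mul_comm, markovTrace_succ]

theorem markovTrace_encircle_tGen_pow_mul (s : ℕ) (b : Y d (m + 1) u) :
    markovTrace d u z x (m + 1) (encircle d m u z x (tGen m ^ s) * b)
      = markovTrace d u z x (m + 1) (encircle d m u z x b * tGen m ^ s) := by
  rw [encircle_tGen_pow, markovTrace_succ, expect_encircledFraming_mul, markovTrace_succ]

theorem markovTrace_encircle_gGen_mul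
    (tr_comm : ∀ a b, markovTrace d u z x (m + 2) (a * b) = markovTrace d u z x (m + 2) (b * a))
    (b : Y d (m + 2) u) :
    markovTrace d u z x (m + 2) (encircle d (m + 1) u z x (gGen m) * b)
      = markovTrace d u z x (m + 2) (encircle d (m + 1) u z x b * gGen m) := by
  refine LinearMap.congr_fun (f := markovTrace d u z x (m + 2)
    ∘ₗ LinearMap.mulLeft ℂ (encircle d (m + 1) u z x (gGen m))) (g := markovTrace d u z x (m + 2)
    ∘ₗ LinearMap.mulRight ℂ (gGen m) ∘ₗ encircle d (m + 1) u z x) (linearMap_ext_last ?_ ?_) b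
  all_goals simp only [LinearMap.comp_apply, LinearMap.mulLeft_apply, LinearMap.mulRight_apply]
  · intro l hl a c
    obtain rfl : m = l := by omega
    have rotate : markovTrace d u z x (m + 2)
          (incl d (m + 1) u a * (gGen m * gGen m) * incl d (m + 1) u c * gGen m)
        = markovTrace d u z x (m + 2)
          (gGen m * incl d (m + 1) u a * gGen m * gGen m * incl d (m + 1) u c) := by
      rw [tr_comm]
      simp only [mul_assoc]
    rw [encircle_mul_incl, encircle_incl_mul, encircle_gGen, mul_smul_comm, smul_mul_assoc,
      smul_mul_assoc, smul_mul_assoc, map_smul, map_smul, rotate, ← mul_assoc, ← mul_assoc,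
      markovTrace_succ (n := m + 1), markovTrace_succ (n := m + 1), expect_mul_incl,
      expect_mul_incl, expect_gGen_sq_mul_incl_mul_gGen]
  · intro a s
    rw [encircle_incl_mul, mul_assoc (incl d (m + 1) u a), tr_comm (incl d (m + 1) u a),
      mul_assoc, markovTrace_encircle_tGen_pow_mul, encircle_mul_incl, mul_assoc]

theorem markovTrace_encircle_mul
    (tr_comm : ∀ a b, markovTrace d u z x (m + 1) (a * b) = markovTrace d u z x (m + 1) (b * a))
    (a b : Y d (m + 1) u) :
    markovTrace d u z x (m + 1) (encircle d m u z x a * b)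
      = markovTrace d u z x (m + 1) (encircle d m u z x b * a) := by
  induction a using induction_bimodule generalizing b with
  | add a a' ha ha' => rw [map_add, add_mul, mul_add, map_add, map_add, ha, ha']
  | incl_mul c a ha =>
    rw [encircle_incl_mul, mul_assoc, tr_comm, mul_assoc, ha, encircle_mul_incl, mul_assoc]
  | mul_incl c a ha =>
    rw [encircle_mul_incl, mul_assoc, ha, encircle_incl_mul, mul_assoc, tr_comm, mul_assoc]
  | g_last l hl =>
    subst hl
    exact markovTrace_encircle_gGen_mul tr_comm b
  | t_last s => exact markovTrace_encircle_tGen_pow_mul s b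

theorem markovTrace_gGen_mul_comm
    (tr_comm : ∀ a b, markovTrace d u z x (m + 1) (a * b) = markovTrace d u z x (m + 1) (b * a))
    (y : Y d (m + 2) u) :
    markovTrace d u z x (m + 2) (gGen m * y) = markovTrace d u z x (m + 2) (y * gGen m) := by
  refine LinearMap.congr_fun (f := markovTrace d u z x (m + 2) ∘ₗ LinearMap.mulLeft ℂ (gGen m))
    (g := markovTrace d u z x (m + 2) ∘ₗ LinearMap.mulRight ℂ (gGen m))
    (linearMap_ext_last ?_ ?_) y
  all_goals simp only [LinearMap.comp_apply, LinearMap.mulLeft_apply, LinearMap.mulRight_apply]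
  · intro l hl a b
    obtain rfl : m = l := by omega
    have regroup : incl d (m + 1) u a * gGen m * incl d (m + 1) u b * gGen m
        = incl d (m + 1) u a * (gGen m * incl d (m + 1) u b * gGen m) := by
      simp only [mul_assoc]
    rw [regroup, ← mul_assoc, ← mul_assoc, markovTrace_succ (n := m + 1),
      markovTrace_succ (n := m + 1), expect_mul_incl, expect_incl_mul, ← encircle_apply,
      ← encircle_apply, markovTrace_encircle_mul tr_comm, tr_comm]
  · intro a s
    have left : gGen m * (incl d (m + 1) u a * tGen (m + 1) ^ s)
        = tGen m ^ s * gGen m * incl d (m + 1) u a := by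
      rw [((commute_incl_tGen a).pow_right s).eq, ← mul_assoc, gGen_mul_tGen_succ_pow]
    rw [left, mul_assoc (incl d (m + 1) u a), markovTrace_succ (n := m + 1),
      markovTrace_succ (n := m + 1), expect_mul_incl, expect_incl_mul,
      expect_tGen_pow_mul_gGen, expect_tGen_succ_pow_mul_gGen, tr_comm]

theorem markovTrace_mul_comm (n : ℕ) (a b : Y d n u) :
    markovTrace d u z x n (a * b) = markovTrace d u z x n (b * a) := by
  induction n with
  | zero => simp only [markovTrace, AlgHom.toLinearMap_apply, map_mul, mul_comm]
  | succ n ih =>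
    refine map_mul_comm_of_generators (fun i hi y => ?_) (fun i hi y => ?_) a b
    · obtain rfl | hin := eq_or_ne n (i + 1)
      · exact markovTrace_gGen_mul_comm ih y
      · rw [← incl_gGen (by omega)]
        exact markovTrace_incl_mul_comm ih _ y
    · obtain rfl | hin := eq_or_ne n i
      · exact markovTrace_tGen_mul_comm y
      · rw [← incl_tGen (by omega)]
        exact markovTrace_incl_mul_comm ih _ y

theorem markovTrace_incl (hx : x 0 = 1) (a : Y d n u) :
    markovTrace d u z x (n + 1) (incl d n u a) = markovTrace d u z x n a := by
  have expect_incl := expect_incl_mul_tGen_pow (z := z) (x := x) a 0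
  rw [pow_zero, mul_one, Nat.cast_zero, hx, one_smul] at expect_incl
  rw [markovTrace_succ, expect_incl]

theorem isMarkovTrace_markovTrace (hx : x 0 = 1) :
    IsMarkovTrace d u z x (markovTrace d u z x) where
  compat n a := markovTrace_incl hx a
  mul_comm := markovTrace_mul_comm
  one n := by
    induction n with
    | zero => rw [markovTrace, AlgHom.toLinearMap_apply, map_one]
    | succ n ih => rw [← map_one (incl d n u), markovTrace_incl hx, ih]
  tr_g n a := by
    have expect_g := expect_incl_mul_gGen_mul_incl (z := z) (x := x) a 1
    rw [map_one, mul_one, mul_one] at expect_g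
    rw [g_eq_gGen, markovTrace_succ (n := n + 1), expect_g, map_smul, smul_eq_mul]
  tr_t n a s _ _ := by
    rw [t_eq_tGen, markovTrace_succ, expect_incl_mul_tGen_pow, map_smul, smul_eq_mul]

end MarkovTrace

namespace IsMarkovTrace

variable {d n m : ℕ} {u z : ℂ} {x : ZMod d → ℂ} {tr tr' : ∀ n : ℕ, Y d n u →ₗ[ℂ] ℂ}

theorem incl_mul_gGen_mul_incl (h : IsMarkovTrace d u z x tr) (a b : Y d (m + 1) u) :
    tr (m + 2) (incl d (m + 1) u a * gGen m * incl d (m + 1) u b) = z * tr (m + 1) (a * b) := by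
  rw [h.mul_comm, ← mul_assoc, ← map_mul (incl d (m + 1) u),
    ← g_eq_gGen m (m + 1).lt_succ_self, h.tr_g, h.mul_comm]

theorem incl_mul_tGen_pow [NeZero d] (h : IsMarkovTrace d u z x tr) (hx : x 0 = 1)
    (a : Y d n u) (s : ℕ) : tr (n + 1) (incl d n u a * tGen n ^ s) = x s * tr n a := by
  rw [← pow_val_natCast (tGen_pow_eq_one n.lt_succ_self) s]
  obtain hs | hs := eq_or_ne (s : ZMod d) 0
  · rw [hs, hx, ZMod.val_zero, pow_zero, mul_one, one_mul, h.compat]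
  · rw [← t_eq_tGen n n.lt_succ_self, h.tr_t n a _ (ZMod.val_pos.2 hs) (ZMod.val_lt _),
      ZMod.natCast_zmod_val]

theorem unique [NeZero d] (h : IsMarkovTrace d u z x tr) (h' : IsMarkovTrace d u z x tr')
    (hx : x 0 = 1) : tr = tr' := by
  funext n
  induction n with
  | zero =>
    ext y
    induction y using induction_mul with
    | one => rw [h.one, h'.one]
    | add a b ha hb => rw [map_add, map_add, ha, hb]
    | smul c a ha => rw [map_smul, map_smul, ha]
    | g_mul i hi => omega
    | t_mul i hi => omega
  | succ n ih =>
    refine linearMap_ext_last (fun m hm a b => ?_) (fun a s => ?_)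
    · subst hm
      rw [h.incl_mul_gGen_mul_incl, h'.incl_mul_gGen_mul_incl, ih]
    · rw [h.incl_mul_tGen_pow hx, h'.incl_mul_tGen_pow hx, ih]

end IsMarkovTrace

section FramingSums

variable {d : ℕ} {A : Type*} [Ring A] {a b c : A}

/-- The sum of the first `d` powers of an element. For `t_j` it is `d` times the projection onto
the invariants of `t_j`. -/
def framingSum (d : ℕ) (a : A) : A := ∑ p ∈ Finset.range d, a ^ p

theorem semiconjBy_framingSum (h : SemiconjBy c a b) :
    SemiconjBy c (framingSum d a) (framingSum d b) := by
  simp only [SemiconjBy, framingSum, Finset.mul_sum, Finset.sum_mul, (h.pow_right _).eq]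

theorem commute_framingSum (h : Commute c a) : Commute c (framingSum d a) :=
  semiconjBy_framingSum h

theorem commute_framingSum_framingSum (h : Commute a b) :
    Commute (framingSum d a) (framingSum d b) :=
  commute_framingSum (commute_framingSum h.symm).symm

theorem commute_framingSum_mul_framingSum_of_swap (hab : Commute a b) (left : SemiconjBy c a b)
    (right : SemiconjBy c b a) : Commute c (framingSum d a * framingSum d b) := by
  have swapped : SemiconjBy c (framingSum d a * framingSum d b)
      (framingSum d b * framingSum d a) :=
    (semiconjBy_framingSum left).mul_right (semiconjBy_framingSum right)
  rwa [(commute_framingSum_framingSum hab).symm.eq] at swapped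

theorem mul_framingSum (ha : a ^ d = 1) : a * framingSum d a = framingSum d a := by
  rw [← sub_eq_zero, ← sub_one_mul, framingSum, mul_geom_sum, ha, sub_self]

theorem framingSum_mul_pow (ha : a ^ d = 1) (s : ℕ) :
    framingSum d a * a ^ s = framingSum d a := by
  induction s with
  | zero => rw [pow_zero, mul_one]
  | succ s ih =>
    rw [pow_succ, ← mul_assoc, ih, ← (commute_framingSum (Commute.refl a)).eq, mul_framingSum ha]

theorem framingSum_eq_sum_zmod [NeZero d] (ha : a ^ d = 1) :
    framingSum d a = ∑ k : ZMod d, a ^ k.val := by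
  simp only [framingSum, ← sum_range_natCast, pow_val_natCast ha]

variable [Algebra ℂ A]

theorem framingSum_mul_self (ha : a ^ d = 1) :
    framingSum d a * framingSum d a = (d : ℂ) • framingSum d a := by
  conv_lhs => rhs; rw [framingSum]
  simp only [Finset.mul_sum, framingSum_mul_pow ha, Finset.sum_const, Finset.card_range,
    Nat.cast_smul_eq_nsmul]

theorem framingSum_mul_framingAverage [NeZero d] (ha : a ^ d = 1) (hb : b ^ d = 1) (m : ℕ) :
    framingSum d a * framingAverage d m a b
      = (1 / d : ℂ) • (framingSum d a * framingSum d b) := by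
  rw [framingAverage_eq_sum_zmod ha hb, mul_smul_comm, Finset.mul_sum, framingSum_eq_sum_zmod hb,
    ← Equiv.sum_comp (Equiv.neg (ZMod d)) (fun k => b ^ k.val), Finset.mul_sum]
  simp only [← mul_assoc, framingSum_mul_pow ha, Equiv.neg_apply]

theorem framingSum_mul_framingSum_mul_framingAverage [NeZero d] (ha : a ^ d = 1)
    (hb : b ^ d = 1) (hab : Commute a b) (m : ℕ) :
    framingSum d a * framingSum d b * framingAverage d m a b
      = framingSum d a * framingSum d b := by
  have comm : Commute (framingSum d a) (framingSum d b) := commute_framingSum_framingSum hab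
  rw [comm.eq, mul_assoc, framingSum_mul_framingAverage ha hb, mul_smul_comm, ← mul_assoc,
    mul_assoc, comm.eq, ← mul_assoc, framingSum_mul_self hb, smul_mul_assoc, smul_smul,
    one_div_mul_cancel (Nat.cast_ne_zero.2 (NeZero.ne d)), one_smul]

theorem sum_framingAverage [NeZero d] (ha : a ^ d = 1) (hb : b ^ d = 1) :
    ∑ k : ZMod d, framingAverage d k.val a b
      = (1 / d : ℂ) • (framingSum d a * framingSum d b) := by
  simp only [framingAverage_eq_sum_zmod ha hb, ZMod.natCast_zmod_val]
  rw [← Finset.smul_sum, Finset.sum_comm, framingSum_eq_sum_zmod ha, framingSum_eq_sum_zmod hb,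
    ← Equiv.sum_comp (Equiv.neg (ZMod d)) (fun k => b ^ k.val), Finset.mul_sum]
  congr 1
  refine Finset.sum_congr rfl fun s _ => ?_
  rw [← Finset.sum_mul, Equiv.neg_apply,
    ← Equiv.sum_comp (Equiv.addRight s) (fun k : ZMod d => a ^ k.val)]
  rfl

end FramingSums

section SteinbergSum

variable {A : Type*} [Ring A] {N a b r : A}

/-- The element `1 + a + b + ab + ba + aba`, of which `steinberg` is the case `a = g_i`,
`b = g_{i+1}`. -/
def steinbergSum (a b : A) : A := 1 + a + b + a * b + b * a + a * b * a

theorem steinbergSum_comm (braid : b * a * b = a * b * a) :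
    steinbergSum a b = steinbergSum b a := by
  rw [steinbergSum, steinbergSum, braid]
  abel

theorem semiconjBy_steinbergSum {a' b' : A} (ha : SemiconjBy r a a') (hb : SemiconjBy r b b') :
    SemiconjBy r (steinbergSum a b) (steinbergSum a' b') :=
  ((((SemiconjBy.one_right r |>.add_right ha).add_right hb).add_right
    (ha.mul_right hb)).add_right (hb.mul_right ha)).add_right ((ha.mul_right hb).mul_right ha)

variable [Algebra ℂ A] {u : ℂ}

theorem mul_mul_steinbergSum (quadratic : N * a * a = u • N + (u - 1) • (N * a)) :
    N * a * steinbergSum a b = u • (N * steinbergSum a b) := by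
  have factor : steinbergSum a b = (1 + a) * (1 + b + b * a) := by
    rw [steinbergSum]
    noncomm_ring
  have eigenvector : N * a * (1 + a) = u • (N * (1 + a)) := by
    rw [mul_add, mul_one, quadratic, mul_add, mul_one]
    module
  rw [factor, ← mul_assoc, ← mul_assoc, eigenvector, smul_mul_assoc]

theorem map_mul_steinbergSum {φ : A →ₗ[ℂ] ℂ} (φ_comm : ∀ a b, φ (a * b) = φ (b * a))
    (comm : Commute N a) (quadratic : N * a * a = u • N + (u - 1) • (N * a)) :
    φ (N * steinbergSum a b)
      = φ N + φ (N * a) + (u + 1) * φ (N * b) + (u + 1) * φ (N * b * a) := by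
  have rotate : φ (N * a * b) = φ (N * b * a) := by
    rw [comm.eq, mul_assoc, φ_comm]
  have rotate_twice : φ (N * a * b * a) = u * φ (N * b) + (u - 1) * φ (N * b * a) := by
    rw [φ_comm, ← mul_assoc, ← mul_assoc, ← comm.eq, quadratic, add_mul, map_add,
      smul_mul_assoc, smul_mul_assoc, map_smul, map_smul, rotate, smul_eq_mul, smul_eq_mul]
  simp only [steinbergSum, mul_add, mul_one, ← mul_assoc, map_add, rotate, rotate_twice]
  ring

end SteinbergSum

section CElements

variable {d n i : ℕ} {u : ℂ}

/-- The product of the framing sums of the strands `i`, `i + 1`, `i + 2`. -/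
def framingSum₃ (i : ℕ) : Y d n u :=
  framingSum d (tGen i) * framingSum d (tGen (i + 1)) * framingSum d (tGen (i + 2))

/-- The element `c_{i,i+1}` in factored form, as a function of a bare index. -/
def cGen (i : ℕ) : Y d n u := framingSum₃ i * steinbergSum (gGen i) (gGen (i + 1))

theorem cElem_eq_cGen (hi : i + 2 < n) : (cElem i hi : Y d n u) = cGen i := by
  simp only [cElem, cGen, steinberg, steinbergSum, g_eq_gGen, t_eq_tGen, framingSum₃, framingSum,
    Finset.sum_mul_sum]
  simp only [Finset.sum_mul]
  exact Finset.sum_congr rfl fun p _ => Finset.sum_comm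

theorem incl_framingSum (hi : i < n) :
    incl d n u (framingSum d (tGen i)) = framingSum d (tGen i) := by
  simp only [framingSum, map_sum, map_pow, incl_tGen hi]

theorem incl_framingSum₃ (hi : i + 2 < n) : incl d n u (framingSum₃ i) = framingSum₃ i := by
  have hi₀ : i < n := by omega
  have hi₁ : i + 1 < n := by omega
  simp only [framingSum₃, map_mul, incl_framingSum hi₀, incl_framingSum hi₁, incl_framingSum hi]

theorem incl_cGen (hi : i + 2 < n) : incl d n u (cGen i) = cGen i := by
  have hi₁ : i + 1 < n := by omega
  simp only [cGen, steinbergSum, map_mul, map_add, map_one, incl_framingSum₃ hi, incl_gGen hi₁,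
    incl_gGen hi]

theorem commute_gGen_framingSum₃ (hi : i + 2 < n) :
    Commute (gGen i : Y d n u) (framingSum₃ i) := by
  have h := yokonumaFamily_gen d n u
  exact (commute_framingSum_mul_framingSum_of_swap (h.t_comm i (i + 1) (by omega) (by omega))
    (h.g_t_left i (by omega)) (h.g_t_right i (by omega))).mul_right
    (commute_framingSum (h.g_t_comm i (i + 2) (by omega) (by omega) (by omega) (by omega)))

theorem commute_gGen_succ_framingSum₃ (hi : i + 2 < n) :
    Commute (gGen (i + 1) : Y d n u) (framingSum₃ i) := by
  have h := yokonumaFamily_gen d n u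
  rw [framingSum₃, mul_assoc]
  exact Commute.mul_right
    (commute_framingSum (h.g_t_comm (i + 1) i (by omega) (by omega) (by omega) (by omega)))
    (commute_framingSum_mul_framingSum_of_swap
      (h.t_comm (i + 1) (i + 2) (by omega) (by omega)) (h.g_t_left (i + 1) (by omega))
      (h.g_t_right (i + 1) (by omega)))

theorem tGen_mul_framingSum₃ {j : ℕ} (hi : i + 2 < n) (hij : i ≤ j) (hji : j ≤ i + 2) :
    (tGen j * framingSum₃ i : Y d n u) = framingSum₃ i := by
  have comm (k : ℕ) (hk : k < n) : Commute (tGen j : Y d n u) (framingSum d (tGen k)) :=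
    commute_framingSum ((yokonumaFamily_gen d n u).t_comm j k (by omega) hk)
  have absorb : (tGen j * framingSum d (tGen j) : Y d n u) = framingSum d (tGen j) :=
    mul_framingSum (tGen_pow_eq_one (by omega))
  obtain rfl | rfl | rfl : j = i ∨ j = i + 1 ∨ j = i + 2 := by omega
  · rw [framingSum₃, ← mul_assoc, ← mul_assoc, absorb]
  · rw [framingSum₃, ← mul_assoc, (comm i (by omega)).left_comm, absorb]
  · rw [framingSum₃, ((comm i (by omega)).mul_right (comm (i + 1) (by omega))).left_comm, absorb]

theorem tGen_mul_cGen {j : ℕ} (hi : i + 2 < n) (hij : i ≤ j) (hji : j ≤ i + 2) :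
    (tGen j * cGen i : Y d n u) = cGen i := by
  rw [cGen, ← mul_assoc, tGen_mul_framingSum₃ hi hij hji]

theorem semiconjBy_ascendingProd_cGen (hi : i + 3 < n) :
    SemiconjBy (ascendingProd gGen i 3 : Y d n u) (cGen i) (cGen (i + 1)) := by
  have h := yokonumaFamily_gen d n u
  have framing (j : ℕ) (hij : i ≤ j) (hji : j < i + 3) :=
    semiconjBy_framingSum (d := d) (h.semiconjBy_ascendingProd_t hi hij hji)
  exact (((framing i (by omega) (by omega)).mul_right
    (framing (i + 1) (by omega) (by omega))).mul_right
    (framing (i + 2) (by omega) (by omega))).mul_right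
    (semiconjBy_steinbergSum (h.semiconjBy_ascendingProd_g hi (by omega) (by omega))
      (h.semiconjBy_ascendingProd_g hi (by omega) (by omega)))

theorem framingSum₃_mul_gGen_sq_of_mul_framingAverage {j : ℕ} (hj : j + 1 < n)
    (absorb : framingSum₃ i * framingAverage d 0 (tGen j) (tGen (j + 1))
      = (framingSum₃ i : Y d n u)) :
    (framingSum₃ i * gGen j * gGen j : Y d n u)
      = u • framingSum₃ i + (u - 1) • (framingSum₃ i * gGen j) := by
  rw [mul_assoc, (yokonumaFamily_gen d n u).quadratic j hj]
  simp only [mul_add, mul_one, mul_smul_comm, ← mul_assoc, absorb]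
  module

variable [NeZero d]

theorem framingSum₃_mul_gGen_sq (hi : i + 2 < n) :
    (framingSum₃ i * gGen i * gGen i : Y d n u)
      = u • framingSum₃ i + (u - 1) • (framingSum₃ i * gGen i) := by
  have h := yokonumaFamily_gen d n u
  have comm (k : ℕ) (hk : k < n) : Commute (framingSum d (tGen (i + 2)) : Y d n u) (tGen k) :=
    (commute_framingSum (h.t_comm k (i + 2) hk hi)).symm
  refine framingSum₃_mul_gGen_sq_of_mul_framingAverage (by omega) ?_
  rw [framingSum₃, mul_assoc,
    (commute_framingAverage 0 (comm i (by omega)) (comm (i + 1) (by omega))).eq, ← mul_assoc,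
    framingSum_mul_framingSum_mul_framingAverage (h.t_pow i (by omega))
      (h.t_pow (i + 1) (by omega)) (h.t_comm i (i + 1) (by omega) (by omega))]

theorem framingSum₃_mul_gGen_succ_sq (hi : i + 2 < n) :
    (framingSum₃ i * gGen (i + 1) * gGen (i + 1) : Y d n u)
      = u • framingSum₃ i + (u - 1) • (framingSum₃ i * gGen (i + 1)) := by
  have h := yokonumaFamily_gen d n u
  refine framingSum₃_mul_gGen_sq_of_mul_framingAverage (by omega) ?_
  rw [framingSum₃, mul_assoc (framingSum d (tGen i)), mul_assoc (framingSum d (tGen i)),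
    framingSum_mul_framingSum_mul_framingAverage (h.t_pow (i + 1) (by omega))
      (h.t_pow (i + 2) (by omega)) (h.t_comm (i + 1) (i + 2) (by omega) (by omega))]

theorem gGen_mul_cGen (hi : i + 2 < n) : (gGen i * cGen i : Y d n u) = u • cGen i := by
  rw [cGen, ← mul_assoc, (commute_gGen_framingSum₃ hi).eq,
    mul_mul_steinbergSum (framingSum₃_mul_gGen_sq hi)]

theorem gGen_succ_mul_cGen (hi : i + 2 < n) :
    (gGen (i + 1) * cGen i : Y d n u) = u • cGen i := by
  rw [cGen, steinbergSum_comm ((yokonumaFamily_gen d n u).braid i hi), ← mul_assoc,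
    (commute_gGen_succ_framingSum₃ hi).eq, mul_mul_steinbergSum (framingSum₃_mul_gGen_succ_sq hi)]

theorem mul_cGen_zero_mem_span (a : Y d 3 u) :
    a * cGen 0 ∈ Submodule.span ℂ {(cGen 0 : Y d 3 u)} := by
  have stable {b : Y d 3 u} {c : ℂ} (hb : b * cGen 0 = c • cGen 0) {y : Y d 3 u}
      (hy : y ∈ Submodule.span ℂ {(cGen 0 : Y d 3 u)}) :
      b * y ∈ Submodule.span ℂ {(cGen 0 : Y d 3 u)} := by
    obtain ⟨r, rfl⟩ := Submodule.mem_span_singleton.1 hy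
    rw [mul_smul_comm, hb]
    exact Submodule.smul_mem _ _ (Submodule.smul_mem _ _ (Submodule.mem_span_singleton_self _))
  induction a using induction_mul with
  | one => rw [one_mul]; exact Submodule.mem_span_singleton_self _
  | add a b ha hb => exact add_mul a b _ ▸ add_mem ha hb
  | smul c a ha => exact smul_mul_assoc c a _ ▸ Submodule.smul_mem _ c ha
  | g_mul i hi a ha =>
    rw [mul_assoc]
    obtain rfl | rfl : i = 0 ∨ i = 1 := by omega
    · exact stable (gGen_mul_cGen (by omega)) ha
    · exact stable (gGen_succ_mul_cGen (i := 0) (by omega)) ha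
  | t_mul i hi a ha =>
    rw [mul_assoc]
    exact stable (c := 1) (by rw [one_smul, tGen_mul_cGen] <;> omega) ha

end CElements

section Invertibility

theorem isUnit_one_add_smul_of_mul_self {A : Type*} [Ring A] [Algebra ℂ A] {u : ℂ} (hu : u ≠ 0)
    {p : A} (hp : p * p = p) : IsUnit (1 + (u - 1) • p) := by
  have expand (v w : ℂ) :
      (1 + (v - 1) • p) * (1 + (w - 1) • p) = 1 + (v * w - 1) • p := by
    simp only [add_mul, mul_add, one_mul, mul_one, smul_mul_assoc, mul_smul_comm, hp]
    module
  refine isUnit_iff_exists.2 ⟨1 + (u⁻¹ - 1) • p, ?_, ?_⟩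
  · rw [expand, mul_inv_cancel₀ hu, sub_self, zero_smul, add_zero]
  · rw [expand, inv_mul_cancel₀ hu, sub_self, zero_smul, add_zero]

variable {d n i : ℕ} [NeZero d] {u : ℂ}

theorem isUnit_gGen (hu : u ≠ 0) (hi : i + 1 < n) : IsUnit (gGen i : Y d n u) := by
  have h := yokonumaFamily_gen d n u
  have hi₀ : i < n := by omega
  have t_comm := h.t_comm i (i + 1) hi₀ hi
  have comm : Commute (gGen i : Y d n u) (framingAverage d 0 (tGen i) (tGen (i + 1))) := by
    have swapped := semiconjBy_framingAverage (d := d) 0 (h.g_t_left i hi) (h.g_t_right i hi)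
    rwa [framingAverage_comm (h.t_pow (i + 1) hi) (h.t_pow i hi₀) t_comm.symm] at swapped
  have factor : gGen i * (gGen i - (u - 1) • framingAverage d 0 (tGen i) (tGen (i + 1)))
      = (1 + (u - 1) • framingAverage d 0 (tGen i) (tGen (i + 1)) : Y d n u) := by
    rw [mul_sub, h.quadratic i hi, mul_smul_comm, comm.eq, add_sub_cancel_right]
  refine (Commute.isUnit_mul_iff ((Commute.refl _).sub_right (comm.smul_right (u - 1)))).1 ?_ |>.1
  rw [factor]
  exact isUnit_one_add_smul_of_mul_self hu
    (framingAverage_mul_self (h.t_pow i hi₀) (h.t_pow (i + 1) hi) t_comm)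

theorem isUnit_ascendingProd_gGen (hu : u ≠ 0) {m : ℕ} (hi : i + m < n) :
    IsUnit (ascendingProd gGen i m : Y d n u) := by
  induction m generalizing i with
  | zero => exact isUnit_one
  | succ m ih => exact (isUnit_gGen hu (by omega)).mul (ih (by omega))

end Invertibility

section PassageToTheQuotient

variable {d n i : ℕ} {u : ℂ}

theorem passesToCTL_iff {φ : Y d n u →ₗ[ℂ] ℂ} :
    PassesToCTL φ ↔ ∀ a ∈ ctlIdeal d n u, φ a = 0 := by
  constructor
  · rintro ⟨ψ, hψ⟩ a ha
    have mk_eq : (ctlIdeal d n u).ringCon.mk' a = (ctlIdeal d n u).ringCon.mk' 0 :=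
      (RingCon.eq _).2 ((TwoSidedIdeal.mem_iff _ _).1 ha)
    rw [← hψ, mk_eq, hψ, map_zero]
  · intro vanish
    have respects (a b : Y d n u) (hab : (ctlIdeal d n u).ringCon a b) : φ a = φ b :=
      sub_eq_zero.1 (map_sub φ a b ▸ vanish _ ((TwoSidedIdeal.rel_iff _ _ _).1 hab))
    exact ⟨{  toFun := fun q => Quotient.liftOn' q φ respects
              map_add' := fun q q' => Quotient.inductionOn₂' q q' (map_add φ)
              map_smul' := fun c q => Quotient.inductionOn' q (map_smul φ c) }, fun _ => rfl⟩

theorem passesToCTL_iff_of_mul_comm {φ : Y d n u →ₗ[ℂ] ℂ}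
    (φ_comm : ∀ a b, φ (a * b) = φ (b * a)) :
    PassesToCTL φ ↔ ∀ i, i + 2 < n → ∀ a, φ (a * cGen i) = 0 := by
  rw [passesToCTL_iff]
  constructor
  · intro vanish i hi a
    refine vanish _ (TwoSidedIdeal.mul_mem_left _ _ _ (TwoSidedIdeal.subset_span ⟨i, hi, ?_⟩))
    rw [cElem_eq_cGen]
  · intro vanish a ha
    suffices ∀ b, φ (b * a) = 0 by simpa using this 1
    induction ha using TwoSidedIdeal.span_induction with
    | mem c hc =>
      obtain ⟨i, hi, rfl⟩ := hc
      simpa only [cElem_eq_cGen] using vanish i hi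
    | zero => exact fun b => (congrArg φ (mul_zero b)).trans (map_zero φ)
    | add c c' _ _ hc hc' => intro b; rw [mul_add, map_add, hc, hc', add_zero]
    | neg c _ hc =>
      intro b
      rw [(congrArg φ (mul_neg b c)).trans (map_neg φ _), hc, neg_zero]
    | left_absorb a c _ hc => intro b; rw [← mul_assoc, hc]
    | right_absorb a c _ hc => intro b; rw [← mul_assoc, φ_comm, ← mul_assoc, hc]

theorem map_mul_eq_zero_of_semiconjBy {A : Type*} [Ring A] [Algebra ℂ A] {φ : A →ₗ[ℂ] ℂ}
    (φ_comm : ∀ a b, φ (a * b) = φ (b * a)) {r c c' : A} (hr : IsUnit r) (hc : SemiconjBy r c c')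
    (vanish : ∀ a, φ (a * c) = 0) (a : A) : φ (a * c') = 0 := by
  obtain ⟨r, rfl⟩ := hr
  rw [← Units.mul_inv_cancel_right c' r, ← hc.eq, ← mul_assoc, φ_comm, ← mul_assoc, ← mul_assoc,
    vanish]

namespace IsMarkovTrace

variable {z : ℂ} {x : ZMod d → ℂ} {tr : ∀ n : ℕ, Y d n u →ₗ[ℂ] ℂ}

theorem tr_eq_of_incl_eq (h : IsMarkovTrace d u z x tr) {c : ∀ n, Y d n u} {k : ℕ}
    (hc : ∀ n, k ≤ n → incl d n u (c n) = c (n + 1)) (hn : k ≤ n) : tr n (c n) = tr k (c k) := by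
  induction n, hn using Nat.le_induction with
  | base => rfl
  | succ n hn ih => rw [← hc n hn, h.compat, ih]

variable [NeZero d]

theorem mul_incl_eq_zero (h : IsMarkovTrace d u z x tr) (hx : x 0 = 1) {c : Y d n u}
    (hc : ∀ a, tr n (a * c) = 0) (a : Y d (n + 1) u) : tr (n + 1) (a * incl d n u c) = 0 := by
  refine LinearMap.congr_fun (f := tr (n + 1) ∘ₗ LinearMap.mulRight ℂ (incl d n u c)) (g := 0)
    (linearMap_ext_last ?_ ?_) a
  all_goals simp only [LinearMap.comp_apply, LinearMap.mulRight_apply, LinearMap.zero_apply]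
  · intro m hm a b
    subst hm
    rw [mul_assoc, ← map_mul (incl d (m + 1) u), h.incl_mul_gGen_mul_incl, ← mul_assoc, hc,
      mul_zero]
  · intro a s
    rw [mul_assoc, ← ((commute_incl_tGen c).pow_right s).eq, ← mul_assoc, ← map_mul (incl d n u),
      h.incl_mul_tGen_pow hx, hc, mul_zero]

theorem mul_cGen_zero_eq_zero (h : IsMarkovTrace d u z x tr) (hx : x 0 = 1)
    (tr_cGen : tr 3 (cGen 0) = 0) (hn : 3 ≤ n) (a : Y d n u) : tr n (a * cGen 0) = 0 := by
  induction n, hn using Nat.le_induction with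
  | base =>
    obtain ⟨r, hr⟩ := Submodule.mem_span_singleton.1 (mul_cGen_zero_mem_span a)
    rw [← hr, map_smul, tr_cGen, smul_zero]
  | succ n hn ih =>
    rw [← incl_cGen hn]
    exact h.mul_incl_eq_zero hx ih a

theorem mul_cGen_eq_zero (h : IsMarkovTrace d u z x tr) (hx : x 0 = 1) (hu : u ≠ 0)
    (tr_cGen : tr 3 (cGen 0) = 0) (hi : i + 2 < n) (a : Y d n u) : tr n (a * cGen i) = 0 := by
  induction i generalizing a with
  | zero => exact h.mul_cGen_zero_eq_zero hx tr_cGen hi a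
  | succ i ih =>
    have hi' : i + 3 < n := by omega
    exact map_mul_eq_zero_of_semiconjBy (h.mul_comm n) (isUnit_ascendingProd_gGen hu hi')
      (semiconjBy_ascendingProd_cGen hi') (ih (by omega)) a

theorem passesToCTL_iff_tr_cGen_zero (h : IsMarkovTrace d u z x tr) (hx : x 0 = 1) (hu : u ≠ 0)
    (hn : 3 ≤ n) : PassesToCTL (tr n) ↔ tr 3 (cGen 0) = 0 := by
  rw [passesToCTL_iff_of_mul_comm (h.mul_comm n)]
  refine ⟨fun vanish => ?_, fun tr_cGen i hi a => h.mul_cGen_eq_zero hx hu tr_cGen hi a⟩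
  rw [← h.tr_eq_of_incl_eq (c := fun _ => cGen 0) (fun _ => incl_cGen) hn]
  simpa only [one_mul] using vanish 0 hn 1

end IsMarkovTrace

end PassageToTheQuotient

section ValuesOfTheTrace

variable {d n : ℕ} {u z : ℂ} {x : ZMod d → ℂ} {tr : ∀ n : ℕ, Y d n u →ₗ[ℂ] ℂ}

theorem framingSum₃_zero :
    (framingSum₃ 0 : Y d 3 u) = incl d 2 u (framingSum d (tGen 0) * framingSum d (tGen 1))
      * framingSum d (tGen 2) := by
  rw [map_mul, incl_framingSum Nat.two_pos, incl_framingSum Nat.one_lt_two, framingSum₃]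

namespace IsMarkovTrace

theorem incl_mul_framingSum_mul_gGen_mul_incl (h : IsMarkovTrace d u z x tr)
    {m : ℕ} (a b : Y d (m + 1) u) :
    tr (m + 2) (incl d (m + 1) u a * framingSum d (tGen (m + 1)) * gGen m * incl d (m + 1) u b)
      = z * tr (m + 1) (a * framingSum d (tGen m) * b) := by
  have slide : (gGen m * framingSum d (tGen m) : Y d (m + 2) u)
      = framingSum d (tGen (m + 1)) * gGen m :=
    (semiconjBy_framingSum ((yokonumaFamily_gen d (m + 2) u).g_t_left m (by omega))).eq
  rw [mul_assoc (incl d (m + 1) u a), ← slide, ← mul_assoc, ← incl_framingSum m.lt_succ_self,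
    mul_assoc, ← map_mul (incl d (m + 1) u), h.incl_mul_gGen_mul_incl, mul_assoc]

theorem tr_framingSum₃_mul_gGen_one_mul_incl (h : IsMarkovTrace d u z x tr) (b : Y d 2 u) :
    tr 3 (framingSum₃ 0 * gGen 1 * incl d 2 u b)
      = d * z * tr 2 (framingSum d (tGen 0) * framingSum d (tGen 1) * b) := by
  rw [framingSum₃_zero, h.incl_mul_framingSum_mul_gGen_mul_incl,
    mul_assoc (framingSum d (tGen 0)), framingSum_mul_self (tGen_pow_eq_one Nat.one_lt_two),
    mul_smul_comm, smul_mul_assoc, map_smul, smul_eq_mul]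
  ring

variable [NeZero d]

theorem incl_mul_framingSum (h : IsMarkovTrace d u z x tr) (hx : x 0 = 1) (a : Y d n u) :
    tr (n + 1) (incl d n u a * framingSum d (tGen n)) = (∑ k, x k) * tr n a := by
  rw [framingSum_eq_sum_zmod (tGen_pow_eq_one n.lt_succ_self)]
  simp only [Finset.mul_sum, Finset.sum_mul, map_sum, h.incl_mul_tGen_pow hx,
    ZMod.natCast_zmod_val]

theorem tr_framingSum (h : IsMarkovTrace d u z x tr) (hx : x 0 = 1) :
    tr 1 (framingSum d (tGen 0)) = ∑ k, x k := by
  simpa only [map_one, one_mul, h.one, mul_one] using h.incl_mul_framingSum hx (1 : Y d 0 u)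

theorem tr_framingSum_mul_framingSum (h : IsMarkovTrace d u z x tr) (hx : x 0 = 1) :
    tr 2 (framingSum d (tGen 0) * framingSum d (tGen 1)) = (∑ k, x k) ^ 2 := by
  rw [← incl_framingSum Nat.one_pos, h.incl_mul_framingSum hx, h.tr_framingSum hx, sq]

theorem tr_framingSum_mul_framingSum_mul_gGen (h : IsMarkovTrace d u z x tr) (hx : x 0 = 1) :
    tr 2 (framingSum d (tGen 0) * framingSum d (tGen 1) * gGen 0) = d * z * ∑ k, x k := by
  have value := h.incl_mul_framingSum_mul_gGen_mul_incl (m := 0) (framingSum d (tGen 0)) 1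
  rw [map_one, mul_one, mul_one, framingSum_mul_self (tGen_pow_eq_one Nat.one_pos), map_smul,
    h.tr_framingSum hx, incl_framingSum Nat.one_pos, smul_eq_mul] at value
  rw [value]
  ring

theorem tr_framingSum₃ (h : IsMarkovTrace d u z x tr) (hx : x 0 = 1) :
    tr 3 (framingSum₃ 0) = (∑ k, x k) ^ 3 := by
  rw [framingSum₃_zero, h.incl_mul_framingSum hx, h.tr_framingSum_mul_framingSum hx]
  ring

theorem tr_framingSum₃_mul_gGen_zero (h : IsMarkovTrace d u z x tr) (hx : x 0 = 1) :
    tr 3 (framingSum₃ 0 * gGen 0) = d * z * (∑ k, x k) ^ 2 := by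
  rw [framingSum₃_zero, ← incl_gGen Nat.one_lt_two, mul_assoc,
    ← (commute_framingSum (commute_incl_tGen _)).eq, ← mul_assoc, ← map_mul (incl d 2 u),
    h.incl_mul_framingSum hx, h.tr_framingSum_mul_framingSum_mul_gGen hx]
  ring

theorem tr_framingSum₃_mul_gGen_one (h : IsMarkovTrace d u z x tr) (hx : x 0 = 1) :
    tr 3 (framingSum₃ 0 * gGen 1) = d * z * (∑ k, x k) ^ 2 := by
  simpa only [map_one, mul_one, h.tr_framingSum_mul_framingSum hx]
    using h.tr_framingSum₃_mul_gGen_one_mul_incl 1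

theorem tr_framingSum₃_mul_gGen_one_mul_gGen_zero (h : IsMarkovTrace d u z x tr) (hx : x 0 = 1) :
    tr 3 (framingSum₃ 0 * gGen 1 * gGen 0) = (d * z) ^ 2 * ∑ k, x k := by
  rw [← incl_gGen Nat.one_lt_two, h.tr_framingSum₃_mul_gGen_one_mul_incl,
    h.tr_framingSum_mul_framingSum_mul_gGen hx]
  ring

theorem tr_cGen_zero (h : IsMarkovTrace d u z x tr) (hx : x 0 = 1) :
    tr 3 (cGen 0) = (∑ k, x k) ^ 3 + (u + 2) * (d * z) * (∑ k, x k) ^ 2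
      + (u + 1) * (d * z) ^ 2 * ∑ k, x k := by
  rw [cGen, map_mul_steinbergSum (h.mul_comm 3) (commute_gGen_framingSum₃ (by omega)).symm
    (framingSum₃_mul_gGen_sq (by omega)), zero_add, h.tr_framingSum₃ hx,
    h.tr_framingSum₃_mul_gGen_zero hx, h.tr_framingSum₃_mul_gGen_one hx,
    h.tr_framingSum₃_mul_gGen_one_mul_gGen_zero hx]
  ring

end IsMarkovTrace

end ValuesOfTheTrace

section Criterion

variable {d n : ℕ} [NeZero d] {u z : ℂ} {x : ZMod d → ℂ} {tr : ∀ n : ℕ, Y d n u →ₗ[ℂ] ℂ}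

theorem sum_E (x : ZMod d → ℂ) : ∑ k, E x k = 1 / d * (∑ k, x k) ^ 2 := by
  have translate (s : ZMod d) : ∑ k, x (k + s) = ∑ k, x k := Equiv.sum_comp (Equiv.addRight s) x
  have reflect : ∑ s, x (-s) = ∑ s, x s := Equiv.sum_comp (Equiv.neg (ZMod d)) x
  simp only [E]
  rw [← Finset.mul_sum, Finset.sum_comm]
  simp only [← Finset.sum_mul, ← Finset.mul_sum, translate, reflect, sq]

theorem sum_e_mul_e (h01 : 0 + 1 < n) (h12 : 1 + 1 < n) :
    ∑ k : ZMod d, (e k.val 0 h01 * e 0 1 h12 : Y d n u)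
      = (1 / d * (1 / d) : ℂ) • framingSum₃ 0 := by
  have t_pow (i : ℕ) (hi : i < n) : (tGen i : Y d n u) ^ d = 1 := tGen_pow_eq_one hi
  have h0 : 0 < n := by omega
  simp only [e, t_eq_tGen, ← Finset.sum_mul]
  rw [sum_framingAverage (t_pow 0 h0) (t_pow (0 + 1) h01), smul_mul_assoc, mul_assoc,
    framingSum_mul_framingAverage (t_pow 1 h01) (t_pow (1 + 1) h12), mul_smul_comm, smul_smul,
    ← mul_assoc, framingSum₃]

theorem IsMarkovTrace.sum_tr_e_mul_e (h : IsMarkovTrace d u z x tr) (hx : x 0 = 1)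
    (h01 : 0 + 1 < n) (h12 : 1 + 1 < n) :
    ∑ k : ZMod d, tr n (e k.val 0 h01 * e 0 1 h12) = 1 / d * (1 / d) * (∑ k, x k) ^ 3 := by
  rw [← map_sum, sum_e_mul_e, map_smul, smul_eq_mul,
    h.tr_eq_of_incl_eq (c := fun _ => framingSum₃ 0) (fun _ => incl_framingSum₃) h12,
    h.tr_framingSum₃ hx]

theorem IsMarkovTrace.passesToCTL_iff (h : IsMarkovTrace d u z x tr) (hx : x 0 = 1)
    (hu : u ≠ 0) (h01 : 0 + 1 < n) (h12 : 1 + 1 < n) :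
    PassesToCTL (tr n) ↔ (u + 1) * z ^ 2 * ∑ k, x k + (u + 2) * z * ∑ k, E x k
      + ∑ k : ZMod d, tr n (e k.val 0 h01 * e 0 1 h12) = 0 := by
  have hd : (d : ℂ) ≠ 0 := Nat.cast_ne_zero.2 (NeZero.ne d)
  have scale (X : ℂ) : X ^ 3 + (u + 2) * (d * z) * X ^ 2 + (u + 1) * (d * z) ^ 2 * X
      = d ^ 2 * ((u + 1) * z ^ 2 * X + (u + 2) * z * (1 / d * X ^ 2)
        + 1 / d * (1 / d) * X ^ 3) := by
    field_simp
    ring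
  rw [h.passesToCTL_iff_tr_cGen_zero hx hu h12, h.tr_cGen_zero hx, h.sum_tr_e_mul_e hx, sum_E,
    scale, mul_eq_zero_iff_left (pow_ne_zero 2 hd)]

theorem IsMarkovTrace.passesToCTL_of_mul_eq_neg_sum (h : IsMarkovTrace d u z x tr) (hx : x 0 = 1)
    (hu : u ≠ 0) (hn : 3 ≤ n) (hz : d * z = -∑ k, x k) : PassesToCTL (tr n) := by
  rw [h.passesToCTL_iff_tr_cGen_zero hx hu hn, h.tr_cGen_zero hx, hz]
  ring

end Criterion

section Counterexample

variable {d : ℕ} [NeZero d] {x : ZMod d → ℂ}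

theorem ECondition.sum_mul_neg_eq_sum (h : ECondition x) (hx : x 0 = 1) (sum_ne : ∑ k, x k ≠ 0) :
    ∑ k, x k * x (-k) = ∑ k, x k := by
  have hd : (d : ℂ) ≠ 0 := Nat.cast_ne_zero.2 (NeZero.ne d)
  have E_eq (k : ZMod d) : E x k = x k * E x 0 := by
    obtain rfl | hk := eq_or_ne k 0
    · rw [hx, one_mul]
    · exact h k hk
  have total : (∑ k, x k) * E x 0 = (∑ k, x k) * (1 / d * ∑ k, x k) := by
    rw [mul_left_comm, ← sq, ← sum_E, Finset.sum_mul]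
    exact Finset.sum_congr rfl fun k _ => (E_eq k).symm
  have E_zero : E x 0 = 1 / d * ∑ k, x k := mul_left_cancel₀ sum_ne total
  simpa only [E, zero_add, mul_right_inj' (one_div_ne_zero hd)] using E_zero

/-- Parameters that violate the E-condition: `x_0 = 1`, and `x_k = 2` for `k ≠ 0`. -/
def twoParam (d : ℕ) (k : ZMod d) : ℂ := if k = 0 then 1 else 2

theorem sum_twoParam : ∑ k, twoParam d k = 2 * d - 1 := by
  have indicator (k : ZMod d) : twoParam d k = 2 - if k = 0 then 1 else 0 := by
    rw [twoParam]
    split_ifs <;> norm_num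
  simp only [indicator, Finset.sum_sub_distrib, Finset.sum_const, Finset.card_univ, ZMod.card,
    Finset.sum_ite_eq', Finset.mem_univ, if_true, nsmul_eq_mul]
  ring

theorem sum_twoParam_mul_neg : ∑ k, twoParam d k * twoParam d (-k) = 4 * d - 3 := by
  have indicator (k : ZMod d) :
      twoParam d k * twoParam d (-k) = 4 - 3 * if k = 0 then 1 else 0 := by
    simp only [twoParam, neg_eq_zero]
    split_ifs <;> norm_num
  simp only [indicator, Finset.sum_sub_distrib, ← Finset.mul_sum, Finset.sum_const,
    Finset.card_univ, ZMod.card, Finset.sum_ite_eq', Finset.mem_univ, if_true, nsmul_eq_mul]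
  ring

theorem not_eCondition_twoParam (hd : 2 ≤ d) : ¬ ECondition (twoParam d) := by
  intro h
  have sum_ne : ∑ k, twoParam d k ≠ 0 := by
    rw [sum_twoParam, sub_ne_zero]
    norm_cast
    omega
  have sums_eq := h.sum_mul_neg_eq_sum (if_pos rfl) sum_ne
  rw [sum_twoParam, sum_twoParam_mul_neg, ← sub_eq_zero] at sums_eq
  have d_eq : (d : ℂ) = 1 := by linear_combination sums_eq / 2
  norm_cast at d_eq
  omega

end Counterexample

end YokonumaHecke

end

theorem mainTheorem3 (d : ℕ) [NeZero d] (u : ℂ) (hu : u ≠ 0) (n : ℕ) (hn : 3 ≤ n) :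
    (∀ (z : ℂ) (x : ZMod d → ℂ), x 0 = 1 →
      (∃! tr : ∀ m : ℕ, YokonumaHecke.Y d m u →ₗ[ℂ] ℂ, YokonumaHecke.IsMarkovTrace d u z x tr) ∧
      ∀ tr : ∀ m : ℕ, YokonumaHecke.Y d m u →ₗ[ℂ] ℂ, YokonumaHecke.IsMarkovTrace d u z x tr →
        (YokonumaHecke.PassesToCTL (tr n) ↔
          (u + 1) * z ^ 2 * ∑ k : ZMod d, x k
            + (u + 2) * z * ∑ k : ZMod d, YokonumaHecke.E x k
            + ∑ k : ZMod d, tr n (YokonumaHecke.e k.val 0 (by omega) *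
                YokonumaHecke.e 0 1 (by omega)) = 0)) ∧
    (2 ≤ d → ∃ (z : ℂ) (x : ZMod d → ℂ) (tr : ∀ m : ℕ, YokonumaHecke.Y d m u →ₗ[ℂ] ℂ),
      x 0 = 1 ∧ YokonumaHecke.IsMarkovTrace d u z x tr ∧
        YokonumaHecke.PassesToCTL (tr n) ∧ ¬ YokonumaHecke.ECondition x) := by
  have exists_trace (z : ℂ) {x : ZMod d → ℂ} (hx : x 0 = 1) :=
    YokonumaHecke.isMarkovTrace_markovTrace (u := u) (z := z) hx
  refine ⟨fun z x hx => ⟨⟨_, exists_trace z hx, fun tr h => h.unique (exists_trace z hx) hx⟩,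
    fun tr h => h.passesToCTL_iff hx hu _ _⟩, fun hd => ?_⟩
  have hx : YokonumaHecke.twoParam d 0 = 1 := if_pos rfl
  have hz : d * (-(∑ k, YokonumaHecke.twoParam d k) / d) = -∑ k, YokonumaHecke.twoParam d k :=
    mul_div_cancel₀ _ (Nat.cast_ne_zero.2 (NeZero.ne d))
  have h := exists_trace (-(∑ k, YokonumaHecke.twoParam d k) / d) hx
  exact ⟨_, _, _, hx, h, h.passesToCTL_of_mul_eq_neg_sum hx hu hn hz,
    YokonumaHecke.not_eCondition_twoParam hd⟩
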